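/- Let $\mathcal G=SL(2,\mathbb R)\times SL(2,\mathbb R)$, and let $\mathcal P=P_1(\mathbb R)\times P_1(\mathbb R)$ carry the $SO(2)\times SO(2)$-invariant measure $\lambda$ given in the affine coordinates $(x,y)$ by $\frac{2\,dx}{1+x^2}\frac{2\,dy}{1+y^2}$. For $g=\begin{pmatrix}a&b\\c&d\end{pmatrix}\in SL(2,\mathbb R)$ put $$xg=\frac{xa+c}{xb+d},\qquad k_g(x)=\left(\frac{(xb+d)^2+(xa+c)^2}{1+x^2}\right)^{1/2},\qquad s_g(x)=\frac{xb+d}{|xb+d|},$$ and let $\mathcal G$ act on (the dual of) the real Hilbert space $L^2(\mathcal P,\lambda,\mathbb R)$ by $$(T'(g,h)\phi)(x,y)=k_g^{-3}(x)s_g(x)\,k_h^{-3}(y)s_h(y)\,\phi(xg,yh).$$ For a subgroup $S$ of $\mathcal G$ let $A(S)$ be the set of $\phi\in L^2(\mathcal P,\lambda,\mathbb R)$ with $T'(s)\phi=\phi$ for all $s\in S$. A potential little group of $\mathcal{HB}$ is a closed subgroup $S$ of $\mathcal G$ with $A(S)\neq\{0\}$. For a positive integer $N$ and integers $q,p$ put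 $$H(N,q,p)=\left\{\left(R(q\theta),R\!\left(p\theta+\tfrac{2\pi}{N}i\right)\right):\theta\in\mathbb R,\ i\in\{0,\dots,N-1\}\right\},\qquad R(\theta)=\begin{pmatrix}\cos\theta&\sin\theta\\-\sin\theta&\cos\theta\end{pmatrix}.$$ Theorem. (1) The infinite closed subgroups $S$ of $SO(2)\times SO(2)$ with $A(S)\ne\{0\}$ are exactly the groups $H(N,q,p)$ with $N$ a positive odd integer and $q,p$ odd and relatively prime integers, $p>0$. (2) Each of these groups is one-dimensional, that is, its Lie algebra has dimension $1$. (3) Consequently the infinite potential little groups of $\mathcal{HB}$ are, up to conjugacy, exactly these groups: a subgroup of $\mathcal G$ is an infinite potential little group if and only if it is conjugate in $\mathcal G$ to some $H(N,q,p)$ with $N$, $q$, $p$ as in (1). -/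

import Mathlib

open MeasureTheory
open scoped MatrixGroups OnePoint

noncomputable section

namespace HB

/-- The group `𝒢 = SL(2,ℝ) × SL(2,ℝ)`. -/
abbrev GG : Type := SL(2, ℝ) × SL(2, ℝ)

/-- The projective line `P₁(ℝ) = ℝ ∪ {∞}`; a row vector `(x₁, x₂) ≠ 0` has coordinate
`x = x₁ / x₂`. -/
abbrev ProjLine : Type := OnePoint ℝ

/-- The Borel σ-algebra of the projective line. -/
instance instMeasurableSpaceProjLine : MeasurableSpace (OnePoint ℝ) := borel (OnePoint ℝ)

/-- The torus `𝒫 = P₁(ℝ) × P₁(ℝ)`. -/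
abbrev Torus : Type := ProjLine × ProjLine

/-- The rotation invariant measure on the projective line: `2 dx / (1 + x²)`, which is `dρ` for
`x = cot (ρ / 2)`. The point `∞` has measure zero. -/
def lineMeasure : Measure ProjLine :=
  ((volume : Measure ℝ).withDensity fun x => ENNReal.ofReal (2 / (1 + x ^ 2))).map
    (fun x : ℝ => (x : OnePoint ℝ))

/-- The `SO(2) × SO(2)`-invariant measure `λ` on the torus. -/
def torusMeasure : Measure Torus := lineMeasure.prod lineMeasure

/-- The real Hilbert space `L²(𝒫, λ, ℝ)`, identified with its topological dual. -/
abbrev L2Torus : Type := Lp ℝ 2 torusMeasure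

/-- A row vector spanning the line with coordinate `x`. -/
def homCoord : ProjLine → Fin 2 → ℝ
  | (x : ℝ) => ![x, 1]
  | ∞ => ![1, 0]

/-- The coordinate `x₁ / x₂` of the line spanned by a nonzero row vector `(x₁, x₂)`. -/
def ofHom (v : Fin 2 → ℝ) : ProjLine :=
  if v 1 = 0 then ∞ else ((v 0 / v 1 : ℝ) : OnePoint ℝ)

/-- The right action `x ↦ x g = (x a + c) / (x b + d)` of `g = [a, b; c, d]`. -/
def moveRight (g : SL(2, ℝ)) (x : ProjLine) : ProjLine :=
  ofHom (Matrix.vecMul (homCoord x) (g : Matrix (Fin 2) (Fin 2) ℝ))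

/-- `k_g(x) = √(((x b + d)² + (x a + c)²) / (1 + x²))`. -/
def kFactor (g : SL(2, ℝ)) (x : ProjLine) : ℝ :=
  let v := homCoord x
  let w := Matrix.vecMul v (g : Matrix (Fin 2) (Fin 2) ℝ)
  Real.sqrt ((w 1 ^ 2 + w 0 ^ 2) / (v 1 ^ 2 + v 0 ^ 2))

/-- `s_g(x) = (x b + d) / |x b + d|`. At the points with `x g = ∞`, which form a null set, the sign
of the first component is taken instead. -/
def sFactor (g : SL(2, ℝ)) (x : ProjLine) : ℝ :=
  let w := Matrix.vecMul (homCoord x) (g : Matrix (Fin 2) (Fin 2) ℝ)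
  if w 1 = 0 then w 0 / |w 0| else w 1 / |w 1|

/-- The dual action
`(T'(g,h) φ)(x,y) = k_g(x)⁻³ s_g(x) k_h(y)⁻³ s_h(y) φ(x g, y h)`. -/
def dualAction (s : GG) (φ : Torus → ℝ) : Torus → ℝ := fun z =>
  (kFactor s.1 z.1 ^ 3)⁻¹ * sFactor s.1 z.1 * ((kFactor s.2 z.2 ^ 3)⁻¹ * sFactor s.2 z.2) *
    φ (moveRight s.1 z.1, moveRight s.2 z.2)

/-- The space `A(S)` of the `φ` in the dual `L²` space with `T'(s) φ = φ` for all `s ∈ S`; equality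
in `L²` is equality almost everywhere. -/
def invariantVectors (S : Subgroup GG) : Set L2Torus :=
  {φ | ∀ s ∈ S, dualAction s φ =ᵐ[torusMeasure] φ}

/-- `A(S)` is not zero. -/
def HasNonzeroInvariant (S : Subgroup GG) : Prop :=
  ∃ φ ∈ invariantVectors S, φ ≠ 0

/-- A potential little group: a closed subgroup of `𝒢` that has nonzero invariant vectors. -/
def IsPotentialLittleGroup (S : Subgroup GG) : Prop :=
  IsClosed (S : Set GG) ∧ HasNonzeroInvariant S

/-- `SO(2)` as a subgroup of `SL(2,ℝ)`. -/
def SO2 : Subgroup SL(2, ℝ) where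
  carrier := {g | (g : Matrix (Fin 2) (Fin 2) ℝ) ∈ Matrix.orthogonalGroup (Fin 2) ℝ}
  one_mem' := by
    simp [one_mem]
  mul_mem' := by
    intro a b ha hb
    simpa using mul_mem ha hb
  inv_mem' := by
    intro a ha
    have h1 : (a : Matrix (Fin 2) (Fin 2) ℝ) * star (a : Matrix (Fin 2) (Fin 2) ℝ) = 1 :=
      (Matrix.mem_orthogonalGroup_iff (Fin 2) ℝ).1 ha
    have h2 : ((a⁻¹ : SL(2, ℝ)) : Matrix (Fin 2) (Fin 2) ℝ) * (a : Matrix (Fin 2) (Fin 2) ℝ) = 1 := by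
      rw [← Matrix.SpecialLinearGroup.coe_mul]; simp
    have h3 : ((a⁻¹ : SL(2, ℝ)) : Matrix (Fin 2) (Fin 2) ℝ)
        = star (a : Matrix (Fin 2) (Fin 2) ℝ) := left_inv_eq_right_inv h2 h1
    change ((a⁻¹ : SL(2, ℝ)) : Matrix (Fin 2) (Fin 2) ℝ) ∈ Matrix.orthogonalGroup (Fin 2) ℝ
    rw [h3]
    exact Unitary.star_mem ha

/-- The maximal compact subgroup `SO(2) × SO(2)` of `𝒢`. -/
def KK : Subgroup GG := SO2.prod SO2

/-- The rotation `R(θ) = [cos θ, sin θ; -sin θ, cos θ]`. -/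
def rot (θ : ℝ) : SL(2, ℝ) :=
  ⟨!![Real.cos θ, Real.sin θ; -Real.sin θ, Real.cos θ], by
    rw [Matrix.det_fin_two_of]
    nlinarith [Real.sin_sq_add_cos_sq θ]⟩

lemma rot_zero : rot 0 = 1 := by
  ext i j
  fin_cases i <;> fin_cases j <;> simp [rot]

lemma rot_add (α β : ℝ) : rot (α + β) = rot α * rot β := by
  ext i j
  rw [Matrix.SpecialLinearGroup.coe_mul, Matrix.mul_apply, Fin.sum_univ_two]
  fin_cases i <;> fin_cases j <;> simp [rot, Real.cos_add, Real.sin_add] <;> ring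

lemma rot_neg (α : ℝ) : rot (-α) = (rot α)⁻¹ := by
  rw [eq_inv_iff_mul_eq_one, ← rot_add, neg_add_cancel, rot_zero]

/-- The group `H(N,q,p) = {(R(qθ), R(pθ + 2πi/N))}`, with `θ` real and `i` an integer (only `i` mod
`N` matters). -/
def H (N : ℕ) (q p : ℤ) : Subgroup GG where
  carrier := {s | ∃ (θ : ℝ) (i : ℤ),
    s = (rot (q * θ), rot (p * θ + 2 * Real.pi / N * i))}
  one_mem' := ⟨0, 0, by simp [rot_zero, Prod.one_eq_mk]⟩
  mul_mem' := by
    rintro _ _ ⟨θ, i, rfl⟩ ⟨η, j, rfl⟩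
    refine ⟨θ + η, i + j, ?_⟩
    rw [Prod.mk_mul_mk, ← rot_add, ← rot_add]
    push_cast
    congr 2 <;> ring
  inv_mem' := by
    rintro _ ⟨θ, i, rfl⟩
    refine ⟨-θ, -i, ?_⟩
    rw [Prod.inv_mk, ← rot_neg, ← rot_neg]
    push_cast
    congr 2 <;> ring

/-- The parameters: `N` is odd (hence positive), `q` and `p` are odd and relatively prime, and the
sign of `(q,p)`, which does not affect `H(N,q,p)`, is fixed by `p > 0`. -/
def Admissible (N : ℕ) (q p : ℤ) : Prop :=
  Odd N ∧ Odd q ∧ Odd p ∧ IsCoprime q p ∧ 0 < p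

/-- The pairs of matrices `X` with `exp (t X) ∈ S` for all real `t`. For a closed subgroup `S` they
form its Lie algebra. -/
def lieAlg (S : Subgroup GG) :
    Set (Matrix (Fin 2) (Fin 2) ℝ × Matrix (Fin 2) (Fin 2) ℝ) :=
  {X | ∀ t : ℝ, ∃ s ∈ S,
    (s.1 : Matrix (Fin 2) (Fin 2) ℝ) = NormedSpace.exp (t • X.1) ∧
    (s.2 : Matrix (Fin 2) (Fin 2) ℝ) = NormedSpace.exp (t • X.2)}

/-- The dimension of a closed subgroup of `𝒢` as a Lie group. -/
def lieDim (S : Subgroup GG) : ℕ :=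
  Module.finrank ℝ (Submodule.span ℝ (lieAlg S))

end HB

end

/-! The proof has three ingredients.

Boundedness. Since `(k⁻³)^(2/3) = k⁻²` is the Jacobian of `x ↦ x g`, a fixed vector `φ` makes
`|φ|^(2/3) dλ` a finite measure invariant under `S` (`density_dualAction`,
`setLIntegral_density_preimage`). If one component `g` of `s ∈ S` has large entries, then `{k_g ≤
1}` and `{k_{g⁻¹} ≤ 1}` have small `λ`-measure (`lineMeasure_shrinkSet_le`). As `k_{g⁻¹}(x g) = 1 /
k_g(x)`, the first set and the preimage under `g` of the second cover the line, so two sets of less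
than half the mass would cover everything. Hence both projections of `S` are bounded. A bounded
subgroup of `SL(2,ℝ)` fixes the unique form of maximal determinant in a compact convex invariant set
of quadratic forms (`exists_invariant_form`), and is therefore conjugate into `SO(2)`.

Fourier analysis. For rotations `k = 1`, and the signs `s_g` become a coboundary on the double cover
of each projective line. There vectors are functions odd in each variable and `T'` is translation
(`pull_dualAction_rot`). A nonzero Fourier coefficient at `(m, n)` forces `m, n` odd and puts `S` in
the kernel of the character `(m, n)` (`HasNonzeroInvariant.exists_character`). Conversely, the real
or the imaginary part of an odd character is an invariant vector
(`hasNonzeroInvariant_of_character`).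

Subgroups of the kernel. Divide `(m, n)` by its gcd `d`, so that the kernel reads `d (p α - q β) ∈
2πℤ`. Its identity component is the circle `(q θ, p θ)`, and an infinite closed subgroup contains
that circle (`mem_of_infinite_of_character`). So `S` is determined by the subgroup of `ℤ` formed by
the values of `d (p α - q β) / 2π`. This subgroup contains `d`, hence is generated by a divisor of
`d`, and `S` is the kernel of `(M p, -M q)` with `M` odd, which is `H(M|q|, q, p)`
(`mem_H_mul_iff`). -/

noncomputable section

namespace HB

/-! ### Homogeneous coordinates and the cocycle identities -/

/-- The last nonzero coordinate of a nonzero row vector. -/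
def lead (v : Fin 2 → ℝ) : ℝ := if v 1 = 0 then v 0 else v 1

@[simp] lemma homCoord_coe (x : ℝ) : homCoord (x : OnePoint ℝ) = ![x, 1] := rfl

@[simp] lemma homCoord_infty : homCoord (∞ : OnePoint ℝ) = ![1, 0] := rfl

lemma lead_homCoord (x : ProjLine) : lead (homCoord x) = 1 := by
  induction x using OnePoint.rec <;> simp [lead]

lemma ofHom_homCoord (x : ProjLine) : ofHom (homCoord x) = x := by
  induction x using OnePoint.rec <;> simp [ofHom]

lemma lead_smul {r : ℝ} (hr : r ≠ 0) (v : Fin 2 → ℝ) : lead (r • v) = r * lead v := by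
  by_cases h : v 1 = 0 <;> simp [lead, h, hr]

lemma ofHom_smul {r : ℝ} (hr : r ≠ 0) (v : Fin 2 → ℝ) : ofHom (r • v) = ofHom v := by
  by_cases h : v 1 = 0 <;> simp [ofHom, h, hr, mul_div_mul_left]

lemma lead_ne_zero {v : Fin 2 → ℝ} (hv : v ≠ 0) : lead v ≠ 0 := by
  by_cases h : v 1 = 0
  · intro h0
    apply hv
    ext i
    fin_cases i
    · simpa [lead, h] using h0
    · simpa using h
  · simp [lead, h]

lemma lead_smul_homCoord (v : Fin 2 → ℝ) : lead v • homCoord (ofHom v) = v := by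
  by_cases h : v 1 = 0
  · ext i
    fin_cases i <;> simp [lead, ofHom, h]
  · ext i
    fin_cases i <;> simp [lead, ofHom, h]
    field_simp

lemma homCoord_ne_zero (x : ProjLine) : homCoord x ≠ 0 := by
  intro h
  have := lead_homCoord x
  simp [h, lead] at this

lemma vecMul_ne_zero (g : SL(2, ℝ)) {v : Fin 2 → ℝ} (hv : v ≠ 0) :
    Matrix.vecMul v (g : Matrix (Fin 2) (Fin 2) ℝ) ≠ 0 := by
  intro h
  apply hv
  have h2 : Matrix.vecMul (Matrix.vecMul v (g : Matrix (Fin 2) (Fin 2) ℝ))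
      ((g⁻¹ : SL(2, ℝ)) : Matrix (Fin 2) (Fin 2) ℝ) = v := by
    rw [Matrix.vecMul_vecMul, ← Matrix.SpecialLinearGroup.coe_mul]
    simp
  rw [← h2, h, Matrix.zero_vecMul]

/-- The factor by which `g` scales the normalized row vector over `x`. -/
def scale (g : SL(2, ℝ)) (x : ProjLine) : ℝ :=
  lead (Matrix.vecMul (homCoord x) (g : Matrix (Fin 2) (Fin 2) ℝ))

lemma scale_ne_zero (g : SL(2, ℝ)) (x : ProjLine) : scale g x ≠ 0 :=
  lead_ne_zero (vecMul_ne_zero g (homCoord_ne_zero x))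

/-- Source of all the cocycle identities: working with vectors and a nonzero scalar avoids treating
the poles of the fractional linear map separately. -/
lemma vecMul_homCoord (g : SL(2, ℝ)) (x : ProjLine) :
    Matrix.vecMul (homCoord x) (g : Matrix (Fin 2) (Fin 2) ℝ) =
      scale g x • homCoord (moveRight g x) :=
  (lead_smul_homCoord _).symm

lemma vecMul_homCoord_mul (g h : SL(2, ℝ)) (x : ProjLine) :
    Matrix.vecMul (homCoord x) ((g * h : SL(2, ℝ)) : Matrix (Fin 2) (Fin 2) ℝ) =
      scale g x • Matrix.vecMul (homCoord (moveRight g x)) (h : Matrix (Fin 2) (Fin 2) ℝ) := by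
  rw [Matrix.SpecialLinearGroup.coe_mul, ← Matrix.vecMul_vecMul, vecMul_homCoord,
    Matrix.smul_vecMul]

lemma moveRight_mul (g h : SL(2, ℝ)) (x : ProjLine) :
    moveRight (g * h) x = moveRight h (moveRight g x) := by
  rw [moveRight, vecMul_homCoord_mul, ofHom_smul (scale_ne_zero g x)]
  rfl

lemma scale_mul (g h : SL(2, ℝ)) (x : ProjLine) :
    scale (g * h) x = scale g x * scale h (moveRight g x) := by
  rw [scale, vecMul_homCoord_mul, lead_smul (scale_ne_zero g x), ← scale]

lemma moveRight_one (x : ProjLine) : moveRight 1 x = x := by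
  simp [moveRight, ofHom_homCoord]

lemma scale_one (x : ProjLine) : scale 1 x = 1 := by
  simp [scale, lead_homCoord]

/-- The squared Euclidean length of a row vector. -/
def normSq (v : Fin 2 → ℝ) : ℝ := v 1 ^ 2 + v 0 ^ 2

lemma normSq_pos {v : Fin 2 → ℝ} (hv : v ≠ 0) : 0 < normSq v := by
  rcases (show 0 ≤ normSq v by unfold normSq; positivity).lt_or_eq with h | h
  · exact h
  · exfalso
    apply hv
    unfold normSq at h
    ext i
    fin_cases i
    · simpa using (by nlinarith [sq_nonneg (v 0), sq_nonneg (v 1)] : v 0 = 0)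
    · simpa using (by nlinarith [sq_nonneg (v 0), sq_nonneg (v 1)] : v 1 = 0)

lemma normSq_smul (r : ℝ) (v : Fin 2 → ℝ) : normSq (r • v) = r ^ 2 * normSq v := by
  simp [normSq]; ring

lemma kFactor_eq (g : SL(2, ℝ)) (x : ProjLine) :
    kFactor g x = √(normSq (Matrix.vecMul (homCoord x) (g : Matrix (Fin 2) (Fin 2) ℝ)) /
      normSq (homCoord x)) := rfl

lemma kFactor_eq_scale (g : SL(2, ℝ)) (x : ProjLine) :
    kFactor g x = √(scale g x ^ 2 * normSq (homCoord (moveRight g x)) / normSq (homCoord x)) := by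
  rw [kFactor_eq, vecMul_homCoord, normSq_smul]

lemma kFactor_pos (g : SL(2, ℝ)) (x : ProjLine) : 0 < kFactor g x :=
  Real.sqrt_pos.2 (div_pos (normSq_pos (vecMul_ne_zero g (homCoord_ne_zero x)))
    (normSq_pos (homCoord_ne_zero x)))

lemma kFactor_sq (g : SL(2, ℝ)) (x : ProjLine) :
    kFactor g x ^ 2 = normSq (Matrix.vecMul (homCoord x) (g : Matrix (Fin 2) (Fin 2) ℝ)) /
      normSq (homCoord x) := by
  rw [kFactor_eq, Real.sq_sqrt]
  exact (div_pos (normSq_pos (vecMul_ne_zero g (homCoord_ne_zero x)))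
    (normSq_pos (homCoord_ne_zero x))).le

/-- The factor is a ratio of lengths of row vectors, so the intermediate length cancels. -/
lemma kFactor_mul (g h : SL(2, ℝ)) (x : ProjLine) :
    kFactor (g * h) x = kFactor g x * kFactor h (moveRight g x) := by
  rw [kFactor_eq_scale, kFactor_eq_scale, kFactor_eq_scale, ← Real.sqrt_mul, scale_mul,
    moveRight_mul]
  · congr 1
    have := (normSq_pos (homCoord_ne_zero (moveRight g x))).ne'
    field_simp
  · have h1 := normSq_pos (homCoord_ne_zero (moveRight g x))
    have h2 := normSq_pos (homCoord_ne_zero x)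
    positivity

lemma kFactor_one (x : ProjLine) : kFactor 1 x = 1 := by
  rw [kFactor_eq]
  simp [div_self (normSq_pos (homCoord_ne_zero x)).ne']

lemma sFactor_eq (g : SL(2, ℝ)) (x : ProjLine) : sFactor g x = scale g x / |scale g x| := by
  unfold sFactor scale lead
  dsimp only
  split_ifs <;> rfl

lemma sFactor_mul (g h : SL(2, ℝ)) (x : ProjLine) :
    sFactor (g * h) x = sFactor g x * sFactor h (moveRight g x) := by
  rw [sFactor_eq, sFactor_eq, sFactor_eq, scale_mul, abs_mul, mul_div_mul_comm]

lemma sFactor_one (x : ProjLine) : sFactor 1 x = 1 := by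
  simp [sFactor_eq, scale_one]

lemma abs_sFactor (g : SL(2, ℝ)) (x : ProjLine) : |sFactor g x| = 1 := by
  rw [sFactor_eq, abs_div, abs_abs, div_self (abs_ne_zero.2 (scale_ne_zero g x))]

/-- The right action of `𝒢` on the torus. -/
def torusMove (s : GG) (z : Torus) : Torus := (moveRight s.1 z.1, moveRight s.2 z.2)

lemma dualAction_mul (s t : GG) (φ : Torus → ℝ) :
    dualAction (s * t) φ = dualAction s (dualAction t φ) := by
  funext z
  simp only [dualAction, Prod.fst_mul, Prod.snd_mul, kFactor_mul, sFactor_mul, moveRight_mul,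
    mul_pow, mul_inv]
  ring

lemma dualAction_one (φ : Torus → ℝ) : dualAction 1 φ = φ := by
  funext z
  simp [dualAction, kFactor_one, sFactor_one, moveRight_one]

lemma abs_dualAction (s : GG) (φ : Torus → ℝ) (z : Torus) :
    |dualAction s φ z| = (kFactor s.1 z.1 ^ 3)⁻¹ * (kFactor s.2 z.2 ^ 3)⁻¹ *
      |φ (torusMove s z)| := by
  have h1 := kFactor_pos s.1 z.1
  have h2 := kFactor_pos s.2 z.2
  rw [dualAction, abs_mul, abs_mul, abs_mul, abs_mul, abs_sFactor, abs_sFactor, mul_one, mul_one,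
    abs_of_pos (by positivity), abs_of_pos (by positivity), torusMove]

lemma kFactor_inv (g : SL(2, ℝ)) (x : ProjLine) :
    kFactor g⁻¹ (moveRight g x) = (kFactor g x)⁻¹ := by
  apply eq_inv_of_mul_eq_one_right
  rw [← kFactor_mul, mul_inv_cancel, kFactor_one]

/-- The squared Hilbert–Schmidt norm of a matrix in `SL(2,ℝ)`. -/
def hsSq (g : SL(2, ℝ)) : ℝ := g 0 0 ^ 2 + g 0 1 ^ 2 + g 1 0 ^ 2 + g 1 1 ^ 2

lemma hsSq_inv (g : SL(2, ℝ)) : hsSq g⁻¹ = hsSq g := by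
  simp [hsSq, Matrix.SpecialLinearGroup.coe_inv, Matrix.adjugate_fin_two]
  ring

lemma kFactor_sq_le (g : SL(2, ℝ)) (x : ProjLine) : kFactor g x ^ 2 ≤ hsSq g := by
  rw [kFactor_sq, div_le_iff₀ (normSq_pos (homCoord_ne_zero x))]
  generalize homCoord x = v
  simp only [normSq, hsSq, Matrix.vecMul, dotProduct, Fin.sum_univ_two]
  nlinarith [sq_nonneg (v 0 * g 1 0 - v 1 * g 0 0), sq_nonneg (v 0 * g 1 1 - v 1 * g 0 1)]

open scoped ENNReal

/-! ### The invariant measure -/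

instance instBorelSpaceProjLine : BorelSpace (OnePoint ℝ) := ⟨rfl⟩

lemma measurable_coe_projLine : Measurable (fun x : ℝ => (x : OnePoint ℝ)) :=
  OnePoint.continuous_coe.measurable

lemma measurableEmbedding_coe_projLine : MeasurableEmbedding (fun x : ℝ => (x : OnePoint ℝ)) :=
  OnePoint.isOpenEmbedding_coe.measurableEmbedding

/-- The affine line is an open embedded copy of `ℝ` and misses a single point, so measurability
needs checking only on `ℝ`. -/
lemma measurable_of_measurable_comp_coe {X : Type*} [MeasurableSpace X] {f : ProjLine → X}
    (hf : Measurable fun x : ℝ => f (x : OnePoint ℝ)) : Measurable f := by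
  intro s hs
  have h : f ⁻¹' s = ((fun x : ℝ => (x : OnePoint ℝ)) '' ((fun x : ℝ => f x) ⁻¹' s)) ∪
      ({(∞ : OnePoint ℝ)} ∩ f ⁻¹' s) := by
    ext x
    induction x using OnePoint.rec <;> simp
  rw [h]
  refine (measurableEmbedding_coe_projLine.measurableSet_image.2 (hf hs)).union ?_
  exact (Set.Subsingleton.anti Set.subsingleton_singleton Set.inter_subset_left).measurableSet

lemma measurable_homCoord : Measurable homCoord := by
  apply measurable_of_measurable_comp_coe
  rw [measurable_pi_iff]
  intro i
  fin_cases i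
  · simpa [homCoord] using measurable_id'
  · simp [homCoord]

lemma measurable_lead : Measurable lead :=
  Measurable.ite (measurableSet_eq_fun (measurable_pi_apply 1) measurable_const)
    (measurable_pi_apply 0) (measurable_pi_apply 1)

lemma measurable_ofHom : Measurable ofHom :=
  Measurable.ite (measurableSet_eq_fun (measurable_pi_apply 1) measurable_const)
    measurable_const
    (measurable_coe_projLine.comp ((measurable_pi_apply 0).div (measurable_pi_apply 1)))

lemma measurable_vecMul (g : SL(2, ℝ)) :
    Measurable fun v : Fin 2 → ℝ => Matrix.vecMul v (g : Matrix (Fin 2) (Fin 2) ℝ) := by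
  apply Continuous.measurable
  fun_prop

lemma measurable_moveRight (g : SL(2, ℝ)) : Measurable (moveRight g) :=
  measurable_ofHom.comp ((measurable_vecMul g).comp measurable_homCoord)

lemma measurable_normSq : Measurable normSq := by
  unfold normSq
  fun_prop

lemma measurable_kFactor (g : SL(2, ℝ)) : Measurable (kFactor g) :=
  ((measurable_normSq.comp ((measurable_vecMul g).comp measurable_homCoord)).div
    (measurable_normSq.comp measurable_homCoord)).sqrt

lemma measurable_scale (g : SL(2, ℝ)) : Measurable (scale g) :=
  measurable_lead.comp ((measurable_vecMul g).comp measurable_homCoord)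

lemma measurable_sFactor (g : SL(2, ℝ)) : Measurable (sFactor g) := by
  have : sFactor g = fun x => scale g x / |scale g x| := funext (sFactor_eq g)
  rw [this]
  exact (measurable_scale g).div (measurable_scale g).abs

lemma measurable_torusMove (s : GG) : Measurable (torusMove s) :=
  ((measurable_moveRight s.1).comp measurable_fst).prodMk
    ((measurable_moveRight s.2).comp measurable_snd)

lemma measurable_dualAction (s : GG) {φ : Torus → ℝ} (hφ : Measurable φ) :
    Measurable (dualAction s φ) := by
  have h1 : Measurable fun z : Torus => (kFactor s.1 z.1 ^ 3)⁻¹ * sFactor s.1 z.1 :=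
    (((measurable_kFactor s.1).pow_const 3).inv.mul (measurable_sFactor s.1)).comp measurable_fst
  have h2 : Measurable fun z : Torus => (kFactor s.2 z.2 ^ 3)⁻¹ * sFactor s.2 z.2 :=
    (((measurable_kFactor s.2).pow_const 3).inv.mul (measurable_sFactor s.2)).comp measurable_snd
  exact (h1.mul h2).mul (hφ.comp (measurable_torusMove s))

lemma measurable_lineDensity : Measurable fun x : ℝ => ENNReal.ofReal (2 / (1 + x ^ 2)) := by
  fun_prop

lemma lintegral_lineMeasure {f : ProjLine → ℝ≥0∞} (hf : Measurable f) :
    ∫⁻ z, f z ∂lineMeasure = ∫⁻ x : ℝ, ENNReal.ofReal (2 / (1 + x ^ 2)) * f (x : OnePoint ℝ) := by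
  rw [lineMeasure, lintegral_map hf measurable_coe_projLine,
    lintegral_withDensity_eq_lintegral_mul _ measurable_lineDensity
      (g := fun x : ℝ => f (x : OnePoint ℝ)) (hf.comp measurable_coe_projLine)]
  rfl

instance : IsFiniteMeasure lineMeasure := by
  constructor
  rw [← lintegral_one, lintegral_lineMeasure measurable_const]
  simp only [mul_one]
  have h : Integrable (fun x : ℝ => 2 / (1 + x ^ 2)) := by
    simpa [div_eq_mul_inv] using integrable_inv_one_add_sq.const_mul 2
  exact h.lintegral_lt_top

lemma lineMeasure_ne_zero : lineMeasure ≠ 0 := by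
  intro h
  have h1 : ∫⁻ z, 1 ∂lineMeasure = 0 := by simp [h]
  rw [lintegral_lineMeasure measurable_const, lintegral_eq_zero_iff (by fun_prop)] at h1
  have h2 : ∀ x : ℝ, ENNReal.ofReal (2 / (1 + x ^ 2)) * 1 ≠ 0 := by
    intro x
    have : 0 < 2 / (1 + x ^ 2) := by positivity
    simpa using this
  have h3 : ∀ᵐ x : ℝ, False := by
    filter_upwards [h1] with x hx
    exact h2 x hx
  simp [ae_iff] at h3

instance : IsFiniteMeasure torusMeasure := by
  unfold torusMeasure
  infer_instance

lemma torusMeasure_ne_zero : torusMeasure ≠ 0 := by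
  intro h
  have h1 : torusMeasure (Set.univ ×ˢ Set.univ) = 0 := by simp [h]
  rw [torusMeasure, Measure.prod_prod, mul_self_eq_zero, Measure.measure_univ_eq_zero] at h1
  exact lineMeasure_ne_zero h1

/-- The density `k_g(x)⁻²` of the pullback of the invariant measure under `g`. -/
def jac (g : SL(2, ℝ)) (x : ProjLine) : ℝ≥0∞ := ENNReal.ofReal ((kFactor g x ^ 2)⁻¹)

lemma measurable_jac (g : SL(2, ℝ)) : Measurable (jac g) :=
  ((measurable_kFactor g).pow_const 2).inv.ennreal_ofReal

lemma jac_ne_zero (g : SL(2, ℝ)) (x : ProjLine) : jac g x ≠ 0 := by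
  have := kFactor_pos g x
  simp only [jac, ne_eq, ENNReal.ofReal_eq_zero, not_le]
  positivity

lemma det_expand (g : SL(2, ℝ)) : g 0 0 * g 1 1 - g 0 1 * g 1 0 = 1 := by
  have := g.det_coe
  rwa [Matrix.det_fin_two] at this

lemma vecMul_coe (g : SL(2, ℝ)) (x : ℝ) :
    Matrix.vecMul (homCoord (x : OnePoint ℝ)) (g : Matrix (Fin 2) (Fin 2) ℝ) =
      ![x * g 0 0 + g 1 0, x * g 0 1 + g 1 1] := by
  ext i
  fin_cases i <;> simp [Matrix.vecMul, dotProduct, Fin.sum_univ_two]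

lemma moveRight_coe (g : SL(2, ℝ)) {x : ℝ} (hx : x * g 0 1 + g 1 1 ≠ 0) :
    moveRight g (x : OnePoint ℝ) =
      (((x * g 0 0 + g 1 0) / (x * g 0 1 + g 1 1) : ℝ) : OnePoint ℝ) := by
  rw [moveRight, vecMul_coe]
  simp [ofHom, hx]

lemma kFactor_sq_coe (g : SL(2, ℝ)) (x : ℝ) :
    kFactor g (x : OnePoint ℝ) ^ 2 =
      ((x * g 0 1 + g 1 1) ^ 2 + (x * g 0 0 + g 1 0) ^ 2) / (1 + x ^ 2) := by
  rw [kFactor_sq, vecMul_coe]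
  simp [normSq]

lemma finite_affine_zeros {b d : ℝ} (h : b ≠ 0 ∨ d ≠ 0) : {x : ℝ | x * b + d = 0}.Finite := by
  by_cases hb : b = 0
  · have : {x : ℝ | x * b + d = 0} = ∅ := by
      ext x
      simpa [hb] using h
    simp [this]
  · apply (Set.finite_singleton (-d / b)).subset
    intro x hx
    have hx : x * b + d = 0 := hx
    rw [Set.mem_singleton_iff]
    field_simp
    linarith

/-- The change of variables formula `∫ k_g(x)⁻² f(x g) dλ = ∫ f dλ` on the projective line. -/
lemma lintegral_jac_moveRight (g : SL(2, ℝ)) {f : ProjLine → ℝ≥0∞} (hf : Measurable f) :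
    ∫⁻ z, jac g z * f (moveRight g z) ∂lineMeasure = ∫⁻ z, f z ∂lineMeasure := by
  have hdet := det_expand g
  set a := g 0 0 with ha
  set b := g 0 1 with hb
  set c := g 1 0 with hc
  set d := g 1 1 with hd
  rw [lintegral_lineMeasure (f := fun z => jac g z * f (moveRight g z))
      ((measurable_jac g).mul (hf.comp (measurable_moveRight g))),
    lintegral_lineMeasure hf]
  set s : Set ℝ := {x | x * b + d ≠ 0} with hs
  have hsm : MeasurableSet s := by
    apply MeasurableSet.compl (s := {x : ℝ | x * b + d = 0})
    exact measurableSet_eq_fun (by fun_prop) measurable_const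
  have hbd : b ≠ 0 ∨ d ≠ 0 := by
    by_contra! h
    rw [h.1, h.2] at hdet
    norm_num at hdet
  have hba : -b ≠ 0 ∨ a ≠ 0 := by
    by_contra! h
    rw [neg_eq_zero.1 h.1, h.2] at hdet
    norm_num at hdet
  have hsc : volume sᶜ = 0 := by
    have : sᶜ = {x : ℝ | x * b + d = 0} := by
      ext x
      simp [hs]
    rw [this]
    exact (finite_affine_zeros hbd).measure_zero _
  set F : ℝ → ℝ := fun x => (x * a + c) / (x * b + d) with hF
  -- The numerator of the quotient rule is the determinant, which is `1`.
  have hder : ∀ x ∈ s, HasDerivWithinAt F (1 / (x * b + d) ^ 2) s x := by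
    intro x hx
    have hx : x * b + d ≠ 0 := hx
    have h1 : HasDerivAt (fun x : ℝ => x * a + c) a x := by
      simpa using ((hasDerivAt_id x).mul_const a).add_const c
    have h2 : HasDerivAt (fun x : ℝ => x * b + d) b x := by
      simpa using ((hasDerivAt_id x).mul_const b).add_const d
    have h3 := (h1.div h2 hx).hasDerivWithinAt (s := s)
    convert! h3 using 1
    congr 1
    linear_combination -hdet
  have hinv : ∀ x ∈ s, F x * (-b) + a ≠ 0 ∧ (F x * d - c) / (F x * (-b) + a) = x := by
    intro x hx
    have hx : x * b + d ≠ 0 := hx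
    have h1 : F x * (-b) + a = 1 / (x * b + d) := by
      simp only [hF]
      field_simp
      linear_combination hdet
    have h2 : F x * d - c = x / (x * b + d) := by
      simp only [hF]
      field_simp
      linear_combination x * hdet
    rw [h1, h2]
    refine ⟨by positivity, by field_simp⟩
  have hinj : Set.InjOn F s := by
    intro x hx y hy hxy
    rw [← (hinv x hx).2, ← (hinv y hy).2, hxy]
  -- The only point that can be missed is the pole of the inverse map `y ↦ (y d - c) / (a - y b)`.
  have himc : volume (F '' s)ᶜ = 0 := by
    apply measure_mono_null _ ((finite_affine_zeros hba).measure_zero volume)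
    intro y hy
    by_contra hy0
    have hy0 : y * (-b) + a ≠ 0 := hy0
    apply hy
    obtain ⟨e, he⟩ : ∃ e, e = y * (-b) + a := ⟨_, rfl⟩
    rw [← he] at hy0
    have h1 : (y * d - c) / e * b + d = 1 / e := by
      field_simp
      linear_combination d * he + hdet
    refine ⟨(y * d - c) / e, ?_, ?_⟩
    · change _ ≠ _
      rw [h1]
      positivity
    · simp only [hF]
      rw [h1]
      field_simp
      linear_combination c * he + y * hdet
  set G : ℝ → ℝ≥0∞ := fun x => ENNReal.ofReal (2 / (1 + x ^ 2)) * f (x : OnePoint ℝ) with hG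
  have key := lintegral_image_eq_lintegral_abs_deriv_mul hsm hder hinj G
  have hr1 : volume.restrict (F '' s) = volume :=
    Measure.restrict_eq_self_of_ae_mem (mem_ae_iff.2 himc)
  have hr2 : volume.restrict s = volume := Measure.restrict_eq_self_of_ae_mem (mem_ae_iff.2 hsc)
  rw [hr1, hr2] at key
  rw [key]
  apply lintegral_congr_ae
  filter_upwards [mem_ae_iff.2 hsc] with x hx
  have hx : x * b + d ≠ 0 := hx
  have hmv := moveRight_coe g hx
  simp only [hG]
  rw [hmv, ← mul_assoc, ← mul_assoc]
  congr 1
  rw [jac, kFactor_sq_coe, ← ENNReal.ofReal_mul (by positivity), ← ENNReal.ofReal_mul (by positivity)]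
  congr 1
  rw [abs_of_pos (by positivity)]
  have h5 : 0 < (x * b + d) ^ 2 + (x * a + c) ^ 2 := by positivity
  have h6 : 0 < 1 + F x ^ 2 := by positivity
  have h7 : (1 + F x ^ 2) * (x * b + d) ^ 2 = (x * b + d) ^ 2 + (x * a + c) ^ 2 := by
    simp only [hF]
    field_simp
  rw [inv_div, div_mul_div_comm, div_mul_div_comm, mul_comm _ (1 + F x ^ 2), h7]
  field_simp
  exact div_self h5.ne'

lemma measurePreserving_moveRight (g : SL(2, ℝ)) :
    MeasurePreserving (moveRight g) (lineMeasure.withDensity (jac g)) lineMeasure := by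
  refine ⟨measurable_moveRight g, ?_⟩
  ext s hs
  rw [Measure.map_apply (measurable_moveRight g) hs,
    withDensity_apply _ (measurable_moveRight g hs), ← lintegral_indicator_one hs,
    ← lintegral_jac_moveRight g (measurable_one.indicator hs),
    ← lintegral_indicator (measurable_moveRight g hs)]
  congr 1 with z
  by_cases h : moveRight g z ∈ s <;> simp [h, Set.indicator]

/-- The density of the pullback of the torus measure under `s`. -/
def torusJac (s : GG) (z : Torus) : ℝ≥0∞ := jac s.1 z.1 * jac s.2 z.2

lemma measurable_torusJac (s : GG) : Measurable (torusJac s) :=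
  ((measurable_jac s.1).comp measurable_fst).mul ((measurable_jac s.2).comp measurable_snd)

lemma measurePreserving_torusMove (s : GG) :
    MeasurePreserving (torusMove s) (torusMeasure.withDensity (torusJac s)) torusMeasure := by
  have h := (measurePreserving_moveRight s.1).prod (measurePreserving_moveRight s.2)
  rwa [prod_withDensity (measurable_jac s.1) (measurable_jac s.2)] at h

lemma lintegral_torusJac_torusMove (s : GG) {f : Torus → ℝ≥0∞} (hf : Measurable f) :
    ∫⁻ z, torusJac s z * f (torusMove s z) ∂torusMeasure = ∫⁻ z, f z ∂torusMeasure := by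
  rw [← (measurePreserving_torusMove s).lintegral_comp hf,
    lintegral_withDensity_eq_lintegral_mul _ (measurable_torusJac s)
      (g := fun z => f (torusMove s z)) (hf.comp (measurable_torusMove s))]
  rfl

/-- The Jacobian never vanishes, so null sets pull back to null sets; this makes the action well
defined on almost everywhere classes. -/
lemma quasiMeasurePreserving_torusMove (s : GG) :
    Measure.QuasiMeasurePreserving (torusMove s) torusMeasure torusMeasure := by
  refine ⟨measurable_torusMove s, ?_⟩
  have h : torusMeasure ≪ torusMeasure.withDensity (torusJac s) :=
    withDensity_absolutelyContinuous' (measurable_torusJac s).aemeasurable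
      (Filter.Eventually.of_forall fun z => mul_ne_zero (jac_ne_zero _ _) (jac_ne_zero _ _))
  have h2 := h.map (measurable_torusMove s)
  rwa [(measurePreserving_torusMove s).map_eq] at h2

lemma dualAction_congr_ae (s : GG) {φ ψ : Torus → ℝ} (h : φ =ᵐ[torusMeasure] ψ) :
    dualAction s φ =ᵐ[torusMeasure] dualAction s ψ := by
  filter_upwards [(quasiMeasurePreserving_torusMove s).ae_eq_comp h] with z hz
  have hz : φ (torusMove s z) = ψ (torusMove s z) := hz
  simp only [torusMove] at hz
  simp only [dualAction, hz]

/-! ### The dual action preserves `L²` -/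

lemma kFactor_inv_sq_le (g : SL(2, ℝ)) (x : ProjLine) : (kFactor g x ^ 2)⁻¹ ≤ hsSq g := by
  rw [← inv_pow, ← kFactor_inv, ← hsSq_inv]
  exact kFactor_sq_le _ _

lemma hsSq_nonneg (g : SL(2, ℝ)) : 0 ≤ hsSq g := by
  unfold hsSq
  positivity

/-- The squared weight `k⁻⁶` is the Jacobian `k⁻²` times `k⁻⁴`, and `k⁻²` is bounded by the squared
Hilbert–Schmidt norm. The action is bounded on `L²`, not isometric in general. -/
lemma memLp_dualAction (s : GG) {φ : Torus → ℝ} (hφ : Measurable φ)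
    (h2 : MemLp φ 2 torusMeasure) : MemLp (dualAction s φ) 2 torusMeasure := by
  refine ⟨(measurable_dualAction s hφ).aestronglyMeasurable, ?_⟩
  have h2' := h2.2
  rw [eLpNorm_lt_top_iff_lintegral_rpow_enorm_lt_top (by simp) (by simp)] at h2' ⊢
  simp only [ENNReal.toReal_ofNat, ENNReal.rpow_ofNat] at h2' ⊢
  set C : ℝ := (hsSq s.1) ^ 2 * (hsSq s.2) ^ 2 with hC
  have hb : ∀ z, ‖dualAction s φ z‖ₑ ^ 2 ≤
      ENNReal.ofReal C * (torusJac s z * ‖φ (torusMove s z)‖ₑ ^ 2) := by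
    intro z
    have e1 := kFactor_pos s.1 z.1
    have e2 := kFactor_pos s.2 z.2
    have n1 := hsSq_nonneg s.1
    have n2 := hsSq_nonneg s.2
    rw [torusJac, jac, jac, Real.enorm_eq_ofReal_abs, Real.enorm_eq_ofReal_abs,
      ← ENNReal.ofReal_pow (abs_nonneg _), ← ENNReal.ofReal_pow (abs_nonneg _),
      ← ENNReal.ofReal_mul (by positivity), ← ENNReal.ofReal_mul (by positivity),
      ← ENNReal.ofReal_mul (by positivity)]
    apply ENNReal.ofReal_le_ofReal
    rw [abs_dualAction]
    have h1 := kFactor_inv_sq_le s.1 z.1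
    have h2 := kFactor_inv_sq_le s.2 z.2
    calc ((kFactor s.1 z.1 ^ 3)⁻¹ * (kFactor s.2 z.2 ^ 3)⁻¹ * |φ (torusMove s z)|) ^ 2
        = (((kFactor s.1 z.1 ^ 2)⁻¹) ^ 2 * ((kFactor s.2 z.2 ^ 2)⁻¹) ^ 2) *
          ((kFactor s.1 z.1 ^ 2)⁻¹ * (kFactor s.2 z.2 ^ 2)⁻¹ * |φ (torusMove s z)| ^ 2) := by
          ring
      _ ≤ C * ((kFactor s.1 z.1 ^ 2)⁻¹ * (kFactor s.2 z.2 ^ 2)⁻¹ * |φ (torusMove s z)| ^ 2) := by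
          rw [hC]
          gcongr
  calc ∫⁻ z, ‖dualAction s φ z‖ₑ ^ 2 ∂torusMeasure
      ≤ ∫⁻ z, ENNReal.ofReal C * (torusJac s z * ‖φ (torusMove s z)‖ₑ ^ 2) ∂torusMeasure :=
        lintegral_mono hb
    _ = ENNReal.ofReal C * ∫⁻ z, ‖φ z‖ₑ ^ 2 ∂torusMeasure := by
        rw [lintegral_const_mul' _ _ ENNReal.ofReal_ne_top,
          lintegral_torusJac_torusMove s (f := fun z => ‖φ z‖ₑ ^ 2) (hφ.enorm.pow_const 2)]
    _ < ⊤ := ENNReal.mul_lt_top ENNReal.ofReal_lt_top h2'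

/-- A nonzero invariant vector can be given by a function. -/
lemma hasNonzeroInvariant_iff (S : Subgroup GG) :
    HasNonzeroInvariant S ↔ ∃ φ : Torus → ℝ, Measurable φ ∧ MemLp φ 2 torusMeasure ∧
      (∀ s ∈ S, dualAction s φ =ᵐ[torusMeasure] φ) ∧ ¬ φ =ᵐ[torusMeasure] 0 := by
  constructor
  · rintro ⟨φ, hφ, h0⟩
    exact ⟨φ, (Lp.stronglyMeasurable φ).measurable, Lp.memLp φ, hφ,
      fun h => h0 ((Lp.eq_zero_iff_ae_eq_zero).2 h)⟩
  · rintro ⟨φ, -, h2, hS, h0⟩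
    have hc := h2.coeFn_toLp
    refine ⟨h2.toLp φ, fun s hs => ?_, fun h => h0 ?_⟩
    · exact (dualAction_congr_ae s hc).trans ((hS s hs).trans hc.symm)
    · exact hc.symm.trans ((Lp.eq_zero_iff_ae_eq_zero).1 h)

/-- `T'(g) φ` is fixed by `g S g⁻¹`, and it is nonzero because `T'(g⁻¹)` undoes `T'(g)`. -/
lemma HasNonzeroInvariant.map_conj {S : Subgroup GG} (h : HasNonzeroInvariant S) (g : GG) :
    HasNonzeroInvariant (S.map (MulAut.conj g).toMonoidHom) := by
  rw [hasNonzeroInvariant_iff] at h ⊢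
  obtain ⟨φ, hm, h2, hS, h0⟩ := h
  refine ⟨dualAction g φ, measurable_dualAction g hm, memLp_dualAction g hm h2, ?_, fun h => h0 ?_⟩
  · rintro _ ⟨s, hs, rfl⟩
    have : dualAction ((MulAut.conj g).toMonoidHom s) (dualAction g φ) =
        dualAction g (dualAction s φ) := by
      rw [← dualAction_mul, ← dualAction_mul]
      simp
    rw [this]
    exact dualAction_congr_ae g (hS s hs)
  · have h1 := dualAction_congr_ae g⁻¹ h
    rw [← dualAction_mul, inv_mul_cancel, dualAction_one] at h1
    refine h1.trans (Filter.Eventually.of_forall fun z => ?_)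
    simp [dualAction]

/-! ### Subgroups with invariant vectors are bounded -/

/-- The set where `g` does not stretch. -/
def shrinkSet (g : SL(2, ℝ)) : Set ProjLine := {x | kFactor g x ≤ 1}

lemma measurableSet_shrinkSet (g : SL(2, ℝ)) : MeasurableSet (shrinkSet g) :=
  measurableSet_le (measurable_kFactor g) measurable_const

/-- In the affine coordinate `k_g ≤ 1` is a quadratic inequality with leading coefficient `A = a² +
b² - 1` and, because `ad - bc = 1`, quarter discriminant `T - 2`. It cuts out an interval of
half-length `√(T - 2) / A`, and the density of the measure is at most `2`. The row hypothesis gives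
`A ≥ (T - 2) / 2`. -/
lemma lineMeasure_shrinkSet_le_of_top_row {g : SL(2, ℝ)} {T : ℝ} (hT : 2 < T) (hg : hsSq g = T)
    (hrow : T / 2 ≤ g 0 0 ^ 2 + g 0 1 ^ 2) :
    lineMeasure (shrinkSet g) ≤ ENNReal.ofReal (8 / √(T - 2)) := by
  have hdet := det_expand g
  obtain ⟨a, ha⟩ : ∃ a, a = g 0 0 := ⟨_, rfl⟩
  obtain ⟨b, hb⟩ : ∃ b, b = g 0 1 := ⟨_, rfl⟩
  obtain ⟨c, hc⟩ : ∃ c, c = g 1 0 := ⟨_, rfl⟩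
  obtain ⟨d, hd⟩ : ∃ d, d = g 1 1 := ⟨_, rfl⟩
  simp only [hsSq] at hg
  rw [← ha, ← hb, ← hc, ← hd] at hdet hg
  rw [← ha, ← hb] at hrow
  set w : ℝ := √(T - 2) with hw
  have hw0 : 0 < w := Real.sqrt_pos.2 (by linarith)
  have hw2 : w ^ 2 = T - 2 := Real.sq_sqrt (by linarith)
  set A : ℝ := a ^ 2 + b ^ 2 - 1 with hA
  have hA0 : w ^ 2 / 2 ≤ A := by rw [hw2]; linarith
  have hApos : 0 < A := by nlinarith
  -- The vertex of the parabola, hence the midpoint of the interval.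
  set m : ℝ := -(a * c + b * d) / A with hm
  have hsub : {x : ℝ | kFactor g (x : OnePoint ℝ) ≤ 1} ⊆ Set.Icc (m - w / A) (m + w / A) := by
    intro x hx
    have hx : kFactor g (x : OnePoint ℝ) ≤ 1 := hx
    have h1 : kFactor g (x : OnePoint ℝ) ^ 2 ≤ 1 := pow_le_one₀ (kFactor_pos _ _).le hx
    rw [kFactor_sq_coe, div_le_one (by positivity), ← ha, ← hb, ← hc, ← hd] at h1
    have hAm : A * m = -(a * c + b * d) := by rw [hm]; field_simp
    have h2 : (A * (x - m)) ^ 2 ≤ w ^ 2 := by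
      have h3 : A * (x - m) = A * x + (a * c + b * d) := by linear_combination -hAm
      have h4 : A * ((x * b + d) ^ 2 + (x * a + c) ^ 2 - (1 + x ^ 2)) ≤ 0 :=
        mul_nonpos_of_nonneg_of_nonpos hApos.le (by linarith)
      have h5 : (A * x + (a * c + b * d)) ^ 2 - w ^ 2 =
          A * ((x * b + d) ^ 2 + (x * a + c) ^ 2 - (1 + x ^ 2)) := by
        rw [hw2, ← hg, hA]
        linear_combination (-1 - (a * d - b * c)) * hdet
      rw [h3]
      linarith
    have h3 := abs_le_of_sq_le_sq' h2 hw0.le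
    have h6 : w / A * A = w := by field_simp
    constructor
    · by_contra hlt
      nlinarith [h3.1, h3.2]
    · by_contra hlt
      nlinarith [h3.1, h3.2]
  have hind : Measurable ((shrinkSet g).indicator (1 : ProjLine → ℝ≥0∞)) :=
    measurable_one.indicator (measurableSet_shrinkSet g)
  rw [← lintegral_indicator_one (measurableSet_shrinkSet g), lintegral_lineMeasure hind]
  calc ∫⁻ x : ℝ, ENNReal.ofReal (2 / (1 + x ^ 2)) *
        (shrinkSet g).indicator (1 : ProjLine → ℝ≥0∞) (x : OnePoint ℝ)
      ≤ ∫⁻ x : ℝ, (Set.Icc (m - w / A) (m + w / A)).indicator (fun _ => ENNReal.ofReal 2) x := by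
        apply lintegral_mono
        intro x
        dsimp only
        by_cases hx : (x : OnePoint ℝ) ∈ shrinkSet g
        · rw [Set.indicator_of_mem hx, Set.indicator_of_mem (hsub hx), Pi.one_apply, mul_one]
          apply ENNReal.ofReal_le_ofReal
          rw [div_le_iff₀ (by positivity)]
          nlinarith [sq_nonneg x]
        · rw [Set.indicator_of_notMem hx]
          simp
    _ = ENNReal.ofReal (2 * (2 * (w / A))) := by
        rw [lintegral_indicator_const measurableSet_Icc, Real.volume_Icc,
          ← ENNReal.ofReal_mul (by norm_num)]
        congr 1
        ring
    _ ≤ ENNReal.ofReal (8 / w) := by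
        apply ENNReal.ofReal_le_ofReal
        rw [le_div_iff₀ hw0]
        have : w / A * w ≤ 2 := by
          rw [div_mul_eq_mul_div, div_le_iff₀ hApos]
          nlinarith
        nlinarith

lemma coe_rot_pi_div_two_mul (g : SL(2, ℝ)) :
    ((rot (Real.pi / 2) * g : SL(2, ℝ)) : Matrix (Fin 2) (Fin 2) ℝ) =
      !![g 1 0, g 1 1; -g 0 0, -g 0 1] := by
  rw [Matrix.SpecialLinearGroup.coe_mul]
  ext i j
  rw [Matrix.mul_apply, Fin.sum_univ_two]
  fin_cases i <;> fin_cases j <;> simp [rot]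

lemma vecMul_rot (v : Fin 2 → ℝ) (θ : ℝ) :
    Matrix.vecMul v (rot θ : Matrix (Fin 2) (Fin 2) ℝ) =
      ![v 0 * Real.cos θ - v 1 * Real.sin θ, v 0 * Real.sin θ + v 1 * Real.cos θ] := by
  ext i
  fin_cases i <;> simp [Matrix.vecMul, dotProduct, Fin.sum_univ_two, rot]
  ring

lemma kFactor_rot (θ : ℝ) (x : ProjLine) : kFactor (rot θ) x = 1 := by
  rw [kFactor_eq, vecMul_rot]
  have h : normSq ![homCoord x 0 * Real.cos θ - homCoord x 1 * Real.sin θ,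
      homCoord x 0 * Real.sin θ + homCoord x 1 * Real.cos θ] = normSq (homCoord x) := by
    simp only [normSq, Matrix.cons_val_zero, Matrix.cons_val_one]
    linear_combination (homCoord x 0 ^ 2 + homCoord x 1 ^ 2) * Real.sin_sq_add_cos_sq θ
  rw [h, div_self (normSq_pos (homCoord_ne_zero x)).ne', Real.sqrt_one]

lemma measurePreserving_rot (θ : ℝ) : MeasurePreserving (moveRight (rot θ)) lineMeasure
    lineMeasure := by
  have h := measurePreserving_moveRight (rot θ)
  have h1 : jac (rot θ) = 1 := by
    funext x
    simp [jac, kFactor_rot]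
  rwa [h1, withDensity_one] at h

lemma lineMeasure_shrinkSet_le {g : SL(2, ℝ)} {T : ℝ} (hT : 2 < T) (hg : hsSq g = T) :
    lineMeasure (shrinkSet g) ≤ ENNReal.ofReal (8 / √(T - 2)) := by
  by_cases hrow : T / 2 ≤ g 0 0 ^ 2 + g 0 1 ^ 2
  · exact lineMeasure_shrinkSet_le_of_top_row hT hg hrow
  -- A quarter turn on the left exchanges the rows up to sign and preserves the measure, so the
  -- heavier row may be taken on top.
  · have h1 : lineMeasure (shrinkSet g) = lineMeasure (shrinkSet (rot (Real.pi / 2) * g)) := by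
      rw [← (measurePreserving_rot (Real.pi / 2)).measure_preimage
        (measurableSet_shrinkSet g).nullMeasurableSet]
      congr 1
      ext x
      simp [shrinkSet, kFactor_mul, kFactor_rot]
    have hg' := hg
    simp only [hsSq] at hg'
    rw [h1]
    apply lineMeasure_shrinkSet_le_of_top_row hT
    · rw [← hg, hsSq, coe_rot_pi_div_two_mul, hsSq]
      simp
      ring
    · rw [coe_rot_pi_div_two_mul]
      simp
      linarith

lemma exists_lineMeasure_shrinkSet_lt {δ : ℝ≥0∞} (hδ : 0 < δ) :
    ∃ T₀ : ℝ, ∀ g : SL(2, ℝ), T₀ < hsSq g → lineMeasure (shrinkSet g) < δ := by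
  obtain ⟨r, hr0, hr⟩ := ENNReal.lt_iff_exists_nnreal_btwn.1 hδ
  have hr0 : 0 < (r : ℝ) := by exact_mod_cast hr0
  refine ⟨2 + (8 / (r : ℝ)) ^ 2, fun g hg => ?_⟩
  have hq : 0 < (8 / (r : ℝ)) ^ 2 := by positivity
  refine lt_of_le_of_lt (lineMeasure_shrinkSet_le (by linarith) rfl) (lt_of_le_of_lt ?_ hr)
  rw [← ENNReal.ofReal_coe_nnreal]
  apply ENNReal.ofReal_le_ofReal
  have h1 : 8 / (r : ℝ) < √(hsSq g - 2) := Real.lt_sqrt_of_sq_lt (by linarith)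
  rw [div_lt_iff₀ hr0] at h1
  rw [div_le_iff₀ (Real.sqrt_pos.2 (by linarith))]
  linarith

/-- The density `|φ|^{2/3}` attached to a vector `φ`. -/
def density (φ : Torus → ℝ) (z : Torus) : ℝ≥0∞ := ‖φ z‖ₑ ^ (2 / 3 : ℝ)

lemma measurable_density {φ : Torus → ℝ} (hφ : Measurable φ) : Measurable (density φ) :=
  hφ.enorm.pow_const _

/-- The exponent `2/3` is the one that turns the weight `k⁻³` into the Jacobian `k⁻²`; absolute
values remove the signs. -/
lemma density_dualAction (s : GG) (φ : Torus → ℝ) (z : Torus) :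
    density (dualAction s φ) z = torusJac s z * density φ (torusMove s z) := by
  have e1 := kFactor_pos s.1 z.1
  have e2 := kFactor_pos s.2 z.2
  have hk : ∀ {k : ℝ}, 0 < k → ((k ^ 3)⁻¹) ^ (2 / 3 : ℝ) = (k ^ 2)⁻¹ := by
    intro k hk
    rw [← inv_pow, ← inv_pow, ← Real.rpow_natCast, ← Real.rpow_mul (by positivity),
      ← Real.rpow_natCast]
    norm_num
  rw [density, density, torusJac, jac, jac, Real.enorm_eq_ofReal_abs, Real.enorm_eq_ofReal_abs,
    ENNReal.ofReal_rpow_of_nonneg (abs_nonneg _) (by norm_num),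
    ENNReal.ofReal_rpow_of_nonneg (abs_nonneg _) (by norm_num),
    ← ENNReal.ofReal_mul (by positivity), ← ENNReal.ofReal_mul (by positivity), abs_dualAction,
    Real.mul_rpow (by positivity) (abs_nonneg _), Real.mul_rpow (by positivity) (by positivity),
    hk e1, hk e2]

/-- On a finite measure space the bound `t^(2/3) ≤ 1 + t²` suffices. -/
lemma lintegral_density_ne_top {φ : Torus → ℝ} (h2 : MemLp φ 2 torusMeasure) :
    ∫⁻ z, density φ z ∂torusMeasure ≠ ⊤ := by
  have h := h2.2
  rw [eLpNorm_lt_top_iff_lintegral_rpow_enorm_lt_top (by simp) (by simp)] at h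
  simp only [ENNReal.toReal_ofNat] at h
  have hle : ∀ z, density φ z ≤ 1 + ‖φ z‖ₑ ^ (2 : ℝ) := by
    intro z
    rcases le_total ‖φ z‖ₑ 1 with h1 | h1
    · exact (ENNReal.rpow_le_one h1 (by norm_num)).trans le_self_add
    · exact (ENNReal.rpow_le_rpow_of_exponent_le h1 (by norm_num)).trans le_add_self
  refine ((lintegral_mono hle).trans_lt ?_).ne
  rw [lintegral_add_left measurable_const]
  exact ENNReal.add_lt_top.2 ⟨by simp, h⟩

lemma setLIntegral_density_preimage {s : GG} {φ : Torus → ℝ} (hφ : Measurable φ)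
    (h : dualAction s φ =ᵐ[torusMeasure] φ) {E : Set Torus} (hE : MeasurableSet E) :
    ∫⁻ z in torusMove s ⁻¹' E, density φ z ∂torusMeasure =
      ∫⁻ z in E, density φ z ∂torusMeasure := by
  rw [← lintegral_indicator (measurable_torusMove s hE), ← lintegral_indicator hE,
    ← lintegral_torusJac_torusMove s ((measurable_density hφ).indicator hE)]
  apply lintegral_congr_ae
  filter_upwards [h] with z hz
  by_cases hz' : torusMove s z ∈ E
  · rw [Set.indicator_of_mem (by exact hz'), Set.indicator_of_mem hz', ← density_dualAction]
    simp only [density, hz]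
  · rw [Set.indicator_of_notMem (by exact hz'), Set.indicator_of_notMem hz', mul_zero]

/-- The entries of the elements of a group with a nonzero invariant vector are bounded. -/
lemma HasNonzeroInvariant.bounded {S : Subgroup GG} (h : HasNonzeroInvariant S) :
    ∃ T : ℝ, ∀ s ∈ S, hsSq s.1 ≤ T ∧ hsSq s.2 ≤ T := by
  rw [hasNonzeroInvariant_iff] at h
  obtain ⟨φ, hm, h2, hS, h0⟩ := h
  set M : ℝ≥0∞ := ∫⁻ z, density φ z ∂torusMeasure with hM
  have hMtop : M ≠ ⊤ := lintegral_density_ne_top h2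
  have hM0 : M ≠ 0 := by
    intro hM0
    rw [hM, lintegral_eq_zero_iff (measurable_density hm)] at hM0
    apply h0
    filter_upwards [hM0] with z hz
    simpa [density] using hz
  -- Absolute continuity: sets of measure below `δ` carry less than half of the mass `M`.
  obtain ⟨δ, hδ, hδM⟩ := exists_pos_setLIntegral_lt_of_measure_lt hMtop
    (ε := M / 2) (by simpa using hM0)
  obtain ⟨δ', hδ', hδδ'⟩ : ∃ δ' : ℝ≥0∞, 0 < δ' ∧ δ' * lineMeasure Set.univ ≤ δ := by
    refine ⟨δ / lineMeasure Set.univ, ENNReal.div_pos hδ.ne' (measure_ne_top _ _), ?_⟩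
    exact ENNReal.le_div_iff_mul_le (Or.inr hδ.ne') (Or.inl (measure_ne_top _ _)) |>.1 le_rfl
  obtain ⟨T, hT⟩ := exists_lineMeasure_shrinkSet_lt hδ'
  have huniv0 : lineMeasure Set.univ ≠ 0 := by
    simpa using lineMeasure_ne_zero
  -- a set of small measure and the preimage of another cannot cover the torus
  have hcover : ∀ s ∈ S, ∀ E F : Set Torus, MeasurableSet E → MeasurableSet F →
      torusMeasure E < δ → torusMeasure F < δ → E ∪ torusMove s ⁻¹' F = Set.univ → False := by
    intro s hs E F hE hF hEδ hFδ hu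
    have h1 := hδM E hEδ
    have h2 := hδM F hFδ
    rw [← setLIntegral_density_preimage hm (hS s hs) hF] at h2
    have h3 : M ≤ ∫⁻ z in E, density φ z ∂torusMeasure +
        ∫⁻ z in torusMove s ⁻¹' F, density φ z ∂torusMeasure := by
      refine le_trans ?_ (lintegral_union_le _ _ _)
      rw [hu, Measure.restrict_univ]
    exact absurd (h3.trans_lt (ENNReal.add_lt_add h1 h2)) (by simp)
  -- Where `g` stretches at `x`, its inverse contracts at `x g`.
  have hstretch : ∀ (g : SL(2, ℝ)) (x : ProjLine),
      x ∈ shrinkSet g ∨ moveRight g x ∈ shrinkSet g⁻¹ := by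
    intro g x
    rcases le_total (kFactor g x) 1 with h | h
    · exact Or.inl h
    · refine Or.inr ?_
      change kFactor g⁻¹ (moveRight g x) ≤ 1
      rw [kFactor_inv]
      exact inv_le_one_of_one_le₀ h
  have hfst : ∀ g : SL(2, ℝ), T < hsSq g → torusMeasure (shrinkSet g ×ˢ Set.univ) < δ := by
    intro g hg
    rw [torusMeasure, Measure.prod_prod]
    exact (ENNReal.mul_lt_mul_left huniv0 (measure_ne_top _ _) (hT g hg)).trans_le hδδ'
  have hsnd : ∀ g : SL(2, ℝ), T < hsSq g → torusMeasure (Set.univ ×ˢ shrinkSet g) < δ := by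
    intro g hg
    rw [torusMeasure, Measure.prod_prod, mul_comm]
    exact (ENNReal.mul_lt_mul_left huniv0 (measure_ne_top _ _) (hT g hg)).trans_le hδδ'
  refine ⟨T, fun s hs => ⟨?_, ?_⟩⟩
  · by_contra! hlt
    refine hcover s hs _ _ ((measurableSet_shrinkSet s.1).prod MeasurableSet.univ)
      ((measurableSet_shrinkSet s.1⁻¹).prod MeasurableSet.univ) (hfst s.1 hlt)
      (hfst s.1⁻¹ (by rwa [hsSq_inv])) ?_
    ext z
    simpa [torusMove] using hstretch s.1 z.1
  · by_contra! hlt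
    refine hcover s hs _ _ (MeasurableSet.univ.prod (measurableSet_shrinkSet s.2))
      (MeasurableSet.univ.prod (measurableSet_shrinkSet s.2⁻¹)) (hsnd s.2 hlt)
      (hsnd s.2⁻¹ (by rwa [hsSq_inv])) ?_
    ext z
    simpa [torusMove] using hstretch s.2 z.2

/-! ### Bounded subgroups of `SL(2,ℝ)` are conjugate to subgroups of `SO(2)` -/

/-- The binary quadratic form `P.1 x² + 2 P.2.1 x y + P.2.2 y²`. -/
def quadForm (P : ℝ × ℝ × ℝ) (x y : ℝ) : ℝ := P.1 * x ^ 2 + 2 * P.2.1 * x * y + P.2.2 * y ^ 2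

/-- The determinant of a binary quadratic form. -/
def quadDet (P : ℝ × ℝ × ℝ) : ℝ := P.1 * P.2.2 - P.2.1 ^ 2

/-- The form `v ↦ P (v s)`. -/
def quadAct (s : SL(2, ℝ)) (P : ℝ × ℝ × ℝ) : ℝ × ℝ × ℝ :=
  (quadForm P (s 0 0) (s 0 1),
    P.1 * s 0 0 * s 1 0 + P.2.1 * (s 0 0 * s 1 1 + s 0 1 * s 1 0) + P.2.2 * s 0 1 * s 1 1,
    quadForm P (s 1 0) (s 1 1))

lemma quadForm_quadAct (s : SL(2, ℝ)) (P : ℝ × ℝ × ℝ) (x y : ℝ) :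
    quadForm (quadAct s P) x y =
      quadForm P (x * s 0 0 + y * s 1 0) (x * s 0 1 + y * s 1 1) := by
  simp only [quadForm, quadAct]
  ring

lemma quadDet_quadAct (s : SL(2, ℝ)) (P : ℝ × ℝ × ℝ) : quadDet (quadAct s P) = quadDet P := by
  have h : quadDet (quadAct s P) = quadDet P * (s 0 0 * s 1 1 - s 0 1 * s 1 0) ^ 2 := by
    simp only [quadForm, quadAct, quadDet]
    ring
  rw [h, det_expand, one_pow, mul_one]

/-- The nonnegative forms dominated by the largest length function over the orbit of a group. -/
def dominatedForms (Γ : Subgroup SL(2, ℝ)) : Set (ℝ × ℝ × ℝ) :=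
  {P | ∀ x y : ℝ, 0 ≤ quadForm P x y ∧ ∀ M : ℝ,
    (∀ t ∈ Γ, (x * t 0 0 + y * t 1 0) ^ 2 + (x * t 0 1 + y * t 1 1) ^ 2 ≤ M) → quadForm P x y ≤ M}

/-- Quantifying over upper bounds `M` instead of taking a supremum exhibits the set as an
intersection of closed half-spaces. -/
lemma isClosed_dominatedForms (Γ : Subgroup SL(2, ℝ)) : IsClosed (dominatedForms Γ) := by
  have hc : ∀ x y : ℝ, Continuous fun P => quadForm P x y := by
    intro x y
    unfold quadForm
    fun_prop
  simp only [dominatedForms, Set.ofPred_forall, Set.ofPred_and]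
  refine isClosed_iInter fun x => isClosed_iInter fun y => IsClosed.inter ?_ ?_
  · exact isClosed_le continuous_const (hc x y)
  · exact isClosed_iInter fun M => isClosed_iInter fun _ => isClosed_le (hc x y) continuous_const

lemma quadDet_nonneg {P : ℝ × ℝ × ℝ} (h : ∀ x y, 0 ≤ quadForm P x y) : 0 ≤ quadDet P := by
  have hp : 0 ≤ P.1 := by simpa [quadForm] using h 1 0
  have hr : 0 ≤ P.2.2 := by simpa [quadForm] using h 0 1
  -- The values of the form at `(q, -p)` and `(-r, q)` are `p` and `r` times the determinant. A
  -- negative determinant thus forces `p = r = 0`, and the value at `(1, -q)` is then `-2q²`.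
  have h1 := h P.2.1 (-P.1)
  have h2 := h (-P.2.2) P.2.1
  simp only [quadForm] at h1 h2
  simp only [quadDet]
  by_contra! hlt
  have e1 : P.1 * (P.1 * P.2.2 - P.2.1 ^ 2) = 0 := by
    apply le_antisymm (mul_nonpos_of_nonneg_of_nonpos hp hlt.le)
    linarith
  have e2 : P.2.2 * (P.1 * P.2.2 - P.2.1 ^ 2) = 0 := by
    apply le_antisymm (mul_nonpos_of_nonneg_of_nonpos hr hlt.le)
    linarith
  have p0 : P.1 = 0 := (mul_eq_zero.1 e1).resolve_right hlt.ne
  have r0 : P.2.2 = 0 := (mul_eq_zero.1 e2).resolve_right hlt.ne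
  have h3 := h 1 (-P.2.1)
  simp only [quadForm, p0, r0] at h3
  rw [p0] at hlt
  nlinarith

lemma isCompact_dominatedForms {Γ : Subgroup SL(2, ℝ)} {T : ℝ} (hT : ∀ s ∈ Γ, hsSq s ≤ T) :
    IsCompact (dominatedForms Γ) := by
  refine ((isCompact_Icc (a := (0 : ℝ)) (b := T)).prod
    ((isCompact_Icc (a := -T) (b := T)).prod (isCompact_Icc (a := (0 : ℝ)) (b := T)))).of_isClosed_subset
    (isClosed_dominatedForms Γ) ?_
  intro P hP
  have hp : 0 ≤ P.1 := by simpa [quadForm] using (hP 1 0).1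
  have hr : 0 ≤ P.2.2 := by simpa [quadForm] using (hP 0 1).1
  have hpT : P.1 ≤ T := by
    have h1 := (hP 1 0).2 T (fun t ht => by
      have := hT t ht
      simp only [hsSq] at this
      nlinarith [sq_nonneg (t 1 0), sq_nonneg (t 1 1)])
    simpa [quadForm] using h1
  have hrT : P.2.2 ≤ T := by
    have h1 := (hP 0 1).2 T (fun t ht => by
      have := hT t ht
      simp only [hsSq] at this
      nlinarith [sq_nonneg (t 0 0), sq_nonneg (t 0 1)])
    simpa [quadForm] using h1
  have hdet := quadDet_nonneg fun x y => (hP x y).1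
  simp only [quadDet] at hdet
  have hq := abs_le_of_sq_le_sq' (show P.2.1 ^ 2 ≤ T ^ 2 by nlinarith) (by linarith)
  exact ⟨⟨hp, hpT⟩, ⟨hq.1, hq.2⟩, hr, hrT⟩

/-- The orbit of `v s` under `Γ` lies in the orbit of `v`, so a bound for the latter also bounds the
former. -/
lemma quadAct_mem_dominatedForms {Γ : Subgroup SL(2, ℝ)} {s : SL(2, ℝ)} (hs : s ∈ Γ)
    {P : ℝ × ℝ × ℝ} (hP : P ∈ dominatedForms Γ) : quadAct s P ∈ dominatedForms Γ := by
  intro x y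
  rw [quadForm_quadAct]
  refine ⟨(hP _ _).1, fun M hM => (hP _ _).2 M fun t ht => ?_⟩
  have h := hM (s * t) (mul_mem hs ht)
  simp only [Matrix.SpecialLinearGroup.coe_mul, Matrix.mul_apply, Fin.sum_univ_two] at h
  refine le_of_eq_of_le ?_ h
  ring

lemma midpoint_mem_dominatedForms {Γ : Subgroup SL(2, ℝ)} {P Q : ℝ × ℝ × ℝ}
    (hP : P ∈ dominatedForms Γ) (hQ : Q ∈ dominatedForms Γ) :
    ((P.1 + Q.1) / 2, (P.2.1 + Q.2.1) / 2, (P.2.2 + Q.2.2) / 2) ∈ dominatedForms Γ := by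
  intro x y
  have h : quadForm ((P.1 + Q.1) / 2, (P.2.1 + Q.2.1) / 2, (P.2.2 + Q.2.2) / 2) x y =
      (quadForm P x y + quadForm Q x y) / 2 := by
    simp only [quadForm]
    ring
  rw [h]
  refine ⟨by linarith [(hP x y).1, (hQ x y).1], fun M hM => ?_⟩
  linarith [(hP x y).2 M hM, (hQ x y).2 M hM]

/-- Strict log-concavity of the determinant on positive forms. -/
lemma eq_of_quadDet_midpoint_le {P Q : ℝ × ℝ × ℝ} (hP : 0 < P.1) (hQ : 0 < Q.1) {D : ℝ}
    (hD : 0 < D) (hPD : quadDet P = D) (hQD : quadDet Q = D)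
    (hmid : quadDet ((P.1 + Q.1) / 2, (P.2.1 + Q.2.1) / 2, (P.2.2 + Q.2.2) / 2) ≤ D) : P = Q := by
  obtain ⟨p, q, r⟩ := P
  obtain ⟨p', q', r'⟩ := Q
  simp only [quadDet] at *
  have h1 : p * r' + p' * r - 2 * q * q' ≤ 2 * D := by linarith
  have h2 : p * p' * (p * r' + p' * r - 2 * q * q' - 2 * D) ≤ 0 :=
    mul_nonpos_of_nonneg_of_nonpos (by positivity) (by linarith)
  -- Substituting `p r = D + q²` and `p' r' = D + q'²` turns the excess of the midpoint determinant,
  -- up to a positive factor, into a sum of squares.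
  have h3 : p * p' * (p * r' + p' * r - 2 * q * q' - 2 * D) =
      D * (p - p') ^ 2 + (p * q' - p' * q) ^ 2 := by
    linear_combination p ^ 2 * hQD + p' ^ 2 * hPD
  have h4 : D * (p - p') ^ 2 = 0 := by
    apply le_antisymm _ (by positivity)
    nlinarith [sq_nonneg (p * q' - p' * q)]
  have h5 : p = p' := by
    have := (mul_eq_zero.1 h4).resolve_left hD.ne'
    exact sub_eq_zero.1 (pow_eq_zero_iff (by norm_num) |>.1 this)
  subst h5
  have h6 : (p * q' - p * q) ^ 2 = 0 := by
    apply le_antisymm _ (by positivity)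
    nlinarith
  have h7 : q' = q := by
    have := pow_eq_zero_iff (by norm_num) |>.1 h6
    exact mul_left_cancel₀ hP.ne' (sub_eq_zero.1 this)
  subst h7
  have h8 : r = r' := mul_left_cancel₀ hP.ne' (by linarith)
  rw [h8]

/-- A maximizer of the determinant is moved by `Γ` to other maximizers, and by convexity and strict
log-concavity there is only one. The standard form is admissible, so the maximum is positive. -/
lemma exists_invariant_form {Γ : Subgroup SL(2, ℝ)} {T : ℝ} (hT : ∀ s ∈ Γ, hsSq s ≤ T) :
    ∃ P : ℝ × ℝ × ℝ, 0 < P.1 ∧ 0 < quadDet P ∧ ∀ s ∈ Γ, quadAct s P = P := by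
  have h1 : ((1, 0, 1) : ℝ × ℝ × ℝ) ∈ dominatedForms Γ := by
    intro x y
    simp only [quadForm]
    refine ⟨by nlinarith [sq_nonneg x, sq_nonneg y], fun M hM => ?_⟩
    have := hM 1 (one_mem Γ)
    simp at this
    linarith
  have hcont : Continuous quadDet := by
    unfold quadDet
    fun_prop
  obtain ⟨P, hP, hmax⟩ := (isCompact_dominatedForms hT).exists_isMaxOn ⟨_, h1⟩ hcont.continuousOn
  have hD : 0 < quadDet P := by
    have : quadDet (1, 0, 1) ≤ quadDet P := hmax h1
    simp only [quadDet] at this ⊢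
    linarith
  have hpos : ∀ Q ∈ dominatedForms Γ, 0 < quadDet Q → 0 < Q.1 := by
    intro Q hQ hQD
    have h0 : 0 ≤ Q.1 := by simpa [quadForm] using (hQ 1 0).1
    refine h0.lt_of_ne fun h => ?_
    simp only [quadDet, ← h] at hQD
    nlinarith [sq_nonneg Q.2.1]
  refine ⟨P, hpos P hP hD, hD, fun s hs => ?_⟩
  have hs' := quadAct_mem_dominatedForms hs hP
  have hsD := quadDet_quadAct s P
  exact eq_of_quadDet_midpoint_le (hpos _ hs' (by rwa [hsD])) (hpos P hP hD) hD hsD rfl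
    (hmax (midpoint_mem_dominatedForms hs' hP))

/-- Cholesky factorization, with the scalar `κ = √det` split off so that the triangular factor has
determinant one. -/
lemma exists_quadForm_eq {P : ℝ × ℝ × ℝ} (hp : 0 < P.1) (hD : 0 < quadDet P) :
    ∃ (κ : ℝ) (k : SL(2, ℝ)), 0 < κ ∧ P = quadAct k (κ, 0, κ) := by
  obtain ⟨p, q, r⟩ := P
  simp only [quadDet] at hp hD
  set κ := √(p * r - q ^ 2) with hκ
  have hκ0 : 0 < κ := Real.sqrt_pos.2 hD
  have hκ2 : κ ^ 2 = p * r - q ^ 2 := Real.sq_sqrt hD.le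
  set a := √(p / κ) with ha
  have ha0 : 0 < a := Real.sqrt_pos.2 (by positivity)
  have ha2 : κ * a ^ 2 = p := by
    rw [Real.sq_sqrt (by positivity)]
    field_simp
  refine ⟨κ, ⟨!![a, 0; q / (κ * a), 1 / a], ?_⟩, hκ0, ?_⟩
  · rw [Matrix.det_fin_two_of]
    field_simp
    ring
  · simp only [quadAct, quadForm, Prod.mk.injEq]
    refine ⟨?_, ?_, ?_⟩
    · simp
      linarith
    · simp
      field_simp
    · simp
      field_simp
      linear_combination r * ha2 - hκ2

lemma mem_SO2_of_quadAct {A : SL(2, ℝ)} {κ : ℝ} (hκ : 0 < κ)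
    (h : quadAct A (κ, 0, κ) = (κ, 0, κ)) : A ∈ SO2 := by
  simp only [quadAct, quadForm, Prod.mk.injEq] at h
  obtain ⟨h1, h2, h3⟩ := h
  have e1 : A 0 0 * A 0 0 + A 0 1 * A 0 1 = 1 := mul_left_cancel₀ hκ.ne' (by linarith)
  have e2 : A 0 0 * A 1 0 + A 0 1 * A 1 1 = 0 := mul_left_cancel₀ hκ.ne' (by linarith)
  have e3 : A 1 0 * A 1 0 + A 1 1 * A 1 1 = 1 := mul_left_cancel₀ hκ.ne' (by linarith)
  change (A : Matrix (Fin 2) (Fin 2) ℝ) ∈ Matrix.orthogonalGroup (Fin 2) ℝ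
  rw [Matrix.mem_orthogonalGroup_iff]
  ext i j
  rw [Matrix.mul_apply, Fin.sum_univ_two]
  fin_cases i <;> fin_cases j <;> simp <;> linarith

lemma quadAct_mul (s t : SL(2, ℝ)) (P : ℝ × ℝ × ℝ) :
    quadAct (s * t) P = quadAct s (quadAct t P) := by
  simp only [quadAct, quadForm, Matrix.SpecialLinearGroup.coe_mul, Matrix.mul_apply,
    Fin.sum_univ_two, Prod.mk.injEq]
  refine ⟨?_, ?_, ?_⟩ <;> ring

lemma quadAct_one (P : ℝ × ℝ × ℝ) : quadAct 1 P = P := by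
  simp [quadAct, quadForm]

lemma exists_conj_mem_SO2 {Γ : Subgroup SL(2, ℝ)} {T : ℝ} (hT : ∀ s ∈ Γ, hsSq s ≤ T) :
    ∃ g : SL(2, ℝ), ∀ s ∈ Γ, g * s * g⁻¹ ∈ SO2 := by
  obtain ⟨P, hp, hD, hinv⟩ := exists_invariant_form hT
  obtain ⟨κ, k, hκ, hP⟩ := exists_quadForm_eq hp hD
  refine ⟨k⁻¹, fun s hs => mem_SO2_of_quadAct hκ ?_⟩
  rw [inv_inv, quadAct_mul, ← hP, quadAct_mul, hinv s hs, hP, ← quadAct_mul, inv_mul_cancel,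
    quadAct_one]

/-- A group with a nonzero invariant vector is conjugate to a subgroup of the maximal compact
subgroup. -/
lemma HasNonzeroInvariant.exists_conj_le_KK {S : Subgroup GG} (h : HasNonzeroInvariant S) :
    ∃ g : GG, S.map (MulAut.conj g).toMonoidHom ≤ KK := by
  obtain ⟨T, hT⟩ := h.bounded
  obtain ⟨g₁, h₁⟩ := exists_conj_mem_SO2 (Γ := S.map (MonoidHom.fst _ _)) (T := T) (by
    rintro _ ⟨s, hs, rfl⟩
    exact (hT s hs).1)
  obtain ⟨g₂, h₂⟩ := exists_conj_mem_SO2 (Γ := S.map (MonoidHom.snd _ _)) (T := T) (by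
    rintro _ ⟨s, hs, rfl⟩
    exact (hT s hs).2)
  refine ⟨(g₁, g₂), ?_⟩
  rintro _ ⟨s, hs, rfl⟩
  exact ⟨h₁ _ ⟨s, hs, rfl⟩, h₂ _ ⟨s, hs, rfl⟩⟩

/-! ### Fourier analysis on the double cover of the torus -/

/-- The unit row vector `(cos 2πt, sin 2πt)`. -/
def circ (t : UnitAddCircle) : Fin 2 → ℝ :=
  ![((AddCircle.toCircle t : Circle) : ℂ).re, ((AddCircle.toCircle t : Circle) : ℂ).im]

lemma circ_coe (x : ℝ) : circ (x : UnitAddCircle) =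
    ![Real.cos (2 * Real.pi * x), Real.sin (2 * Real.pi * x)] := by
  rw [circ, AddCircle.toCircle_apply_mk, Circle.coe_exp, Complex.exp_ofReal_mul_I_re,
    Complex.exp_ofReal_mul_I_im, div_one]

/-- The point of `ℝ / ℤ` with angle `α`. -/
def angle (α : ℝ) : UnitAddCircle := ((α / (2 * Real.pi) : ℝ) : UnitAddCircle)

lemma circ_add_angle (t : UnitAddCircle) (α : ℝ) :
    circ (t + angle α) = Matrix.vecMul (circ t) (rot α : Matrix (Fin 2) (Fin 2) ℝ) := by
  induction t using QuotientAddGroup.induction_on with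
  | H x =>
    have h : 2 * Real.pi * (x + α / (2 * Real.pi)) = 2 * Real.pi * x + α := by
      have := Real.pi_ne_zero
      field_simp
    rw [angle, ← AddCircle.coe_add, circ_coe]
    erw [circ_coe]
    rw [h, vecMul_rot, Real.cos_add, Real.sin_add]
    ext i
    fin_cases i <;> simp [add_comm]

lemma circ_add_angle_pi (t : UnitAddCircle) : circ (t + angle Real.pi) = (-1 : ℝ) • circ t := by
  rw [circ_add_angle, vecMul_rot]
  ext i
  fin_cases i <;> simp

lemma circ_ne_zero (t : UnitAddCircle) : circ t ≠ 0 := by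
  intro h
  have h0 : ((AddCircle.toCircle t : Circle) : ℂ).re = 0 := by simpa [circ] using congrFun h 0
  have h1 : ((AddCircle.toCircle t : Circle) : ℂ).im = 0 := by simpa [circ] using congrFun h 1
  exact Circle.coe_ne_zero _ (Complex.ext h0 h1)

/-- The double cover of the projective line. -/
def cover (t : UnitAddCircle) : ProjLine := ofHom (circ t)

/-- The sign of the normalization of `circ t`. -/
def coverSign (t : UnitAddCircle) : ℝ := lead (circ t) / |lead (circ t)|

lemma measurable_circ : Measurable circ := by
  apply Continuous.measurable
  have h : Continuous fun t : UnitAddCircle => ((AddCircle.toCircle t : Circle) : ℂ) :=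
    continuous_subtype_val.comp AddCircle.continuous_toCircle
  refine continuous_pi fun i => ?_
  fin_cases i
  · exact Complex.continuous_re.comp h
  · exact Complex.continuous_im.comp h

lemma measurable_cover : Measurable cover := measurable_ofHom.comp measurable_circ

lemma measurable_coverSign : Measurable coverSign :=
  (measurable_lead.comp measurable_circ).div (measurable_lead.comp measurable_circ).abs

lemma abs_coverSign (t : UnitAddCircle) : |coverSign t| = 1 := by
  rw [coverSign, abs_div, abs_abs, div_self (abs_ne_zero.2 (lead_ne_zero (circ_ne_zero t)))]

lemma vecMul_eq_smul {v : Fin 2 → ℝ} (g : SL(2, ℝ)) :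
    Matrix.vecMul v (g : Matrix (Fin 2) (Fin 2) ℝ) =
      lead v • Matrix.vecMul (homCoord (ofHom v)) (g : Matrix (Fin 2) (Fin 2) ℝ) := by
  rw [← Matrix.smul_vecMul, lead_smul_homCoord]

lemma moveRight_rot_cover (α : ℝ) (t : UnitAddCircle) :
    moveRight (rot α) (cover t) = cover (t + angle α) := by
  rw [cover, cover, circ_add_angle, vecMul_eq_smul, ofHom_smul (lead_ne_zero (circ_ne_zero t))]
  rfl

/-- On the double cover the sign cocycle of the rotations is a coboundary, so multiplying by
`coverSign` removes it. -/
lemma coverSign_mul_sFactor_rot (α : ℝ) (t : UnitAddCircle) :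
    coverSign t * sFactor (rot α) (cover t) = coverSign (t + angle α) := by
  rw [coverSign, coverSign, circ_add_angle, vecMul_eq_smul,
    lead_smul (lead_ne_zero (circ_ne_zero t)), sFactor_eq, abs_mul, mul_div_mul_comm]
  rfl

/-- The cover is two-to-one with deck translation by a half period. One sheet is parametrized by `x
= cot 2πt`, whose Jacobian produces `1 / (1 + x²)`. -/
lemma lintegral_cover {f : ProjLine → ℝ≥0∞} (hf : Measurable f) :
    ∫⁻ t, f (cover t) ∂(volume : Measure UnitAddCircle) =
      ENNReal.ofReal (1 / (2 * Real.pi)) * ∫⁻ z, f z ∂lineMeasure := by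
  have hpi := Real.pi_pos
  set g : ℝ → ℝ≥0∞ := fun x => f (cover (x : UnitAddCircle)) with hg
  have hgm : Measurable g := hf.comp (measurable_cover.comp AddCircle.measurable_mk')
  have h0 : ∫⁻ t, f (cover t) ∂(volume : Measure UnitAddCircle) = ∫⁻ x in Set.Ioc (0 : ℝ) 1, g x := by
    have h := (UnitAddCircle.measurePreserving_mk 0).lintegral_comp (hf.comp measurable_cover)
    rw [zero_add] at h
    exact h.symm
  have hper : ∀ x : ℝ, g (x + 1 / 2) = g x := by
    intro x
    have h1 : ((x + 1 / 2 : ℝ) : UnitAddCircle) = (x : UnitAddCircle) + angle Real.pi := by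
      rw [angle, AddCircle.coe_add]
      congr 2
      field_simp
    simp only [hg]
    rw [h1, cover, circ_add_angle_pi, ofHom_smul (by norm_num)]
    rfl
  have h2 : ∫⁻ x in Set.Ioc (1 / 2 : ℝ) 1, g x = ∫⁻ x in Set.Ioc (0 : ℝ) (1 / 2), g x := by
    rw [← (measurePreserving_add_right volume (1 / 2 : ℝ)).setLIntegral_comp_preimage
      measurableSet_Ioc hgm]
    have : (fun x : ℝ => x + 1 / 2) ⁻¹' Set.Ioc (1 / 2 : ℝ) 1 = Set.Ioc (0 : ℝ) (1 / 2) := by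
      ext x
      simp only [Set.mem_preimage, Set.mem_Ioc]
      constructor <;> rintro ⟨h1, h2⟩ <;> constructor <;> linarith
    rw [this]
    simp only [hper]
  have h3 : ∫⁻ x in Set.Ioc (0 : ℝ) 1, g x = 2 * ∫⁻ x in Set.Ioo (0 : ℝ) (1 / 2), g x := by
    rw [← Set.Ioc_union_Ioc_eq_Ioc (show (0 : ℝ) ≤ 1 / 2 by norm_num) (by norm_num),
      lintegral_union measurableSet_Ioc (Set.Ioc_disjoint_Ioc_of_le le_rfl), h2, two_mul,
      setLIntegral_congr Ioo_ae_eq_Ioc]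
  set τ : ℝ → ℝ := fun x => (Real.pi / 2 - Real.arctan x) / (2 * Real.pi) with hτ
  have h4 : τ '' Set.univ = Set.Ioo (0 : ℝ) (1 / 2) := by
    ext y
    simp only [Set.image_univ, Set.mem_range, Set.mem_Ioo, hτ]
    constructor
    · rintro ⟨x, rfl⟩
      have e1 := Real.arctan_lt_pi_div_two x
      have e2 := Real.neg_pi_div_two_lt_arctan x
      constructor
      · apply div_pos <;> linarith
      · rw [div_lt_iff₀ (by linarith)]
        linarith
    · rintro ⟨e1, e2⟩
      refine ⟨Real.tan (Real.pi / 2 - 2 * Real.pi * y), ?_⟩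
      rw [Real.arctan_tan (by nlinarith) (by nlinarith)]
      field_simp
      ring
  have hder : ∀ x ∈ Set.univ, HasDerivWithinAt τ (-(1 / (1 + x ^ 2)) / (2 * Real.pi)) Set.univ x := by
    intro x _
    exact (((Real.hasDerivAt_arctan x).const_sub _).div_const _).hasDerivWithinAt
  have hinj : Set.InjOn τ Set.univ := by
    intro x _ y _ hxy
    simp only [hτ] at hxy
    apply Real.arctan_injective
    rw [div_left_inj' (by positivity)] at hxy
    linarith
  have hcov : ∀ x : ℝ, cover (τ x : UnitAddCircle) = (x : OnePoint ℝ) := by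
    intro x
    have e : 2 * Real.pi * τ x = Real.pi / 2 - Real.arctan x := by
      simp only [hτ]
      field_simp
    have hc := Real.cos_arctan_pos x
    rw [cover, circ_coe, e, Real.cos_pi_div_two_sub, Real.sin_pi_div_two_sub, ofHom]
    simp [hc.ne']
    rw [← Real.tan_eq_sin_div_cos, Real.tan_arctan]
  rw [h0, h3, ← h4, lintegral_image_eq_lintegral_abs_deriv_mul MeasurableSet.univ hder hinj,
    lintegral_lineMeasure hf, Measure.restrict_univ, ← lintegral_const_mul' _ _ (by simp),
    ← lintegral_const_mul' _ _ ENNReal.ofReal_ne_top]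
  apply lintegral_congr
  intro x
  simp only [hg, hcov]
  rw [← mul_assoc, ← mul_assoc]
  congr 1
  rw [← ENNReal.ofReal_mul (by positivity), neg_div, abs_neg, abs_of_pos (by positivity),
    show (2 : ℝ≥0∞) = ENNReal.ofReal 2 by simp, ← ENNReal.ofReal_mul (by positivity)]
  congr 1
  field_simp

lemma volume_eq_haarAddCircle :
    (volume : Measure UnitAddCircle) = AddCircle.haarAddCircle := by
  rw [AddCircle.volume_eq_smul_haarAddCircle]
  simp

lemma measurePreserving_cover : MeasurePreserving cover
    (AddCircle.haarAddCircle : Measure UnitAddCircle)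
    (ENNReal.ofReal (1 / (2 * Real.pi)) • lineMeasure) := by
  refine ⟨measurable_cover, ?_⟩
  ext s hs
  rw [Measure.map_apply measurable_cover hs, Measure.smul_apply, smul_eq_mul,
    ← lintegral_indicator_one hs, ← lintegral_cover (measurable_one.indicator hs),
    volume_eq_haarAddCircle, ← lintegral_indicator_one (measurable_cover hs)]
  rfl

/-- The `2²`-fold cover of the torus. -/
def torusCover (t : UnitAddTorus (Fin 2)) : Torus := (cover (t 0), cover (t 1))

/-- The normalized Haar measure on the cover. -/
abbrev haarTorus : Measure (UnitAddTorus (Fin 2)) :=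
  Measure.pi fun _ => AddCircle.haarAddCircle

lemma measurePreserving_torusCover : ∃ c : ℝ≥0∞, c ≠ 0 ∧ c ≠ ⊤ ∧
    MeasurePreserving torusCover haarTorus (c • torusMeasure) := by
  have hpi := Real.pi_pos
  set c := ENNReal.ofReal (1 / (2 * Real.pi)) with hc
  have hc0 : c ≠ 0 := by
    simp only [hc, ne_eq, ENNReal.ofReal_eq_zero, not_le]
    positivity
  refine ⟨c * c, mul_ne_zero hc0 hc0, ENNReal.mul_ne_top ENNReal.ofReal_ne_top
    ENNReal.ofReal_ne_top, ?_⟩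
  have h1 := measurePreserving_finTwoArrow (AddCircle.haarAddCircle : Measure UnitAddCircle)
  have : SFinite (c • lineMeasure) := by infer_instance
  have h2 := measurePreserving_cover.prod measurePreserving_cover
  rw [Measure.prod_smul_left, Measure.prod_smul_right, smul_smul] at h2
  exact h2.comp h1

open UnitAddTorus in
/-- A nonzero square integrable function on a torus has a nonzero Fourier coefficient. -/
lemma exists_mFourierCoeff_ne_zero {F : UnitAddTorus (Fin 2) → ℂ} (h2 : MemLp F 2 haarTorus)
    (h0 : ¬ F =ᵐ[haarTorus] 0) : ∃ n : Fin 2 → ℤ, mFourierCoeff F n ≠ 0 := by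
  by_contra! hn
  apply h0
  have hz : h2.toLp F = 0 := by
    apply mFourierBasis.repr.injective
    rw [map_zero]
    ext n
    refine (mFourierBasis_repr (h2.toLp F) n).trans ?_
    refine Eq.trans ?_ (hn n)
    apply integral_congr_ae
    filter_upwards [h2.coeFn_toLp] with t ht
    rw [ht]
  exact h2.coeFn_toLp.symm.trans ((Lp.eq_zero_iff_ae_eq_zero).1 hz)

open UnitAddTorus in
/-- Frequencies of a function that is multiplied by `z` under translation by `a`. -/
lemma mFourier_eq_of_translate {F : UnitAddTorus (Fin 2) → ℂ} {a : UnitAddTorus (Fin 2)} {z : ℂ}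
    (h : (fun t => F (t + a)) =ᵐ[haarTorus] fun t => z * F t) {n : Fin 2 → ℤ}
    (hn : mFourierCoeff F n ≠ 0) : mFourier n a = z := by
  have h1 : mFourierCoeff F n = mFourier (-n) a * (z * mFourierCoeff F n) := by
    calc mFourierCoeff F n = ∫ t, mFourier (-n) t * F t ∂haarTorus := rfl
      _ = ∫ t, mFourier (-n) (t + a) * F (t + a) ∂haarTorus :=
        (integral_add_right_eq_self (μ := haarTorus) (fun t => mFourier (-n) t * F t) a).symm
      _ = ∫ t, mFourier (-n) a * (z * (mFourier (-n) t * F t)) ∂haarTorus := by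
        apply integral_congr_ae
        filter_upwards [h] with t ht
        have h3 : mFourier (-n) (t + a) = mFourier (-n) t * mFourier (-n) a := by
          simp only [mFourier, ContinuousMap.coe_mk, Pi.add_apply, fourier_apply, zsmul_add,
            AddCircle.toCircle_add, Circle.coe_mul, Finset.prod_mul_distrib]
        rw [ht, h3]
        ring
      _ = mFourier (-n) a * (z * mFourierCoeff F n) := by
        rw [integral_const_mul, integral_const_mul]
        rfl
  have h2 : mFourier (-n) a * z = 1 := by
    apply mul_right_cancel₀ hn
    rw [one_mul, mul_assoc]
    exact h1.symm
  have h3 : mFourier n a * mFourier (-n) a = 1 := by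
    rw [← mFourier_add, add_neg_cancel, mFourier_zero]
    rfl
  calc mFourier n a = mFourier n a * (mFourier (-n) a * z) := by rw [h2, mul_one]
    _ = z := by rw [← mul_assoc, h3, one_mul]

/-- The translation of the cover induced by `(rot α, rot β)`. -/
def shift (α β : ℝ) : UnitAddTorus (Fin 2) := ![angle α, angle β]

lemma mFourier_shift (n : Fin 2 → ℤ) (α β : ℝ) :
    UnitAddTorus.mFourier n (shift α β) =
      Complex.exp (((n 0 * α + n 1 * β : ℝ) : ℂ) * Complex.I) := by
  have hpi : (Real.pi : ℂ) ≠ 0 := by exact_mod_cast Real.pi_ne_zero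
  simp only [UnitAddTorus.mFourier, ContinuousMap.coe_mk, Fin.prod_univ_two, shift,
    Matrix.cons_val_zero, Matrix.cons_val_one, angle, fourier_coe_apply]
  rw [← Complex.exp_add]
  congr 1
  push_cast
  field_simp

/-- The pullback of a vector to an odd function on the cover. -/
def pull (φ : Torus → ℝ) (t : UnitAddTorus (Fin 2)) : ℝ :=
  coverSign (t 0) * coverSign (t 1) * φ (torusCover t)

lemma norm_pull (φ : Torus → ℝ) (t : UnitAddTorus (Fin 2)) : ‖pull φ t‖ = ‖φ (torusCover t)‖ := by
  rw [pull, Real.norm_eq_abs, abs_mul, abs_mul, abs_coverSign, abs_coverSign, one_mul, one_mul,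
    Real.norm_eq_abs]

lemma measurable_torusCover : Measurable torusCover :=
  (measurable_cover.comp (measurable_pi_apply 0)).prodMk
    (measurable_cover.comp (measurable_pi_apply 1))

lemma measurable_pull {φ : Torus → ℝ} (hφ : Measurable φ) : Measurable (pull φ) := by
  have h0 : Measurable fun t : UnitAddTorus (Fin 2) => coverSign (t 0) :=
    measurable_coverSign.comp (measurable_pi_apply 0)
  have h1 : Measurable fun t : UnitAddTorus (Fin 2) => coverSign (t 1) :=
    measurable_coverSign.comp (measurable_pi_apply 1)
  exact (h0.mul h1).mul (hφ.comp measurable_torusCover)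

lemma pull_dualAction_rot (α β : ℝ) (φ : Torus → ℝ) (t : UnitAddTorus (Fin 2)) :
    pull (dualAction (rot α, rot β) φ) t = pull φ (t + shift α β) := by
  simp only [pull, dualAction, torusCover, kFactor_rot, moveRight_rot_cover, Pi.add_apply, shift,
    Matrix.cons_val_zero, Matrix.cons_val_one, ← coverSign_mul_sFactor_rot]
  ring

lemma angle_zero : angle 0 = 0 := by
  simp [angle]

lemma cover_add_angle_pi (t : UnitAddCircle) : cover (t + angle Real.pi) = cover t := by
  rw [cover, circ_add_angle_pi, ofHom_smul (by norm_num), cover]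

lemma coverSign_add_angle_pi (t : UnitAddCircle) :
    coverSign (t + angle Real.pi) = -coverSign t := by
  rw [coverSign, circ_add_angle_pi, lead_smul (by norm_num), coverSign, neg_one_mul, abs_neg,
    neg_div]

/-- A half turn changes the vector but not the line it spans, so only the sign flips. This oddness
makes the frequencies odd. -/
lemma pull_add_pi_left (φ : Torus → ℝ) (t : UnitAddTorus (Fin 2)) :
    pull φ (t + shift Real.pi 0) = -pull φ t := by
  simp only [pull, torusCover, shift, Pi.add_apply, Matrix.cons_val_zero, Matrix.cons_val_one,
    angle_zero, add_zero, cover_add_angle_pi, coverSign_add_angle_pi]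
  ring

lemma pull_add_pi_right (φ : Torus → ℝ) (t : UnitAddTorus (Fin 2)) :
    pull φ (t + shift 0 Real.pi) = -pull φ t := by
  simp only [pull, torusCover, shift, Pi.add_apply, Matrix.cons_val_zero, Matrix.cons_val_one,
    angle_zero, add_zero, cover_add_angle_pi, coverSign_add_angle_pi]
  ring

lemma odd_of_exp_eq_neg_one {m : ℤ} (h : Complex.exp (((m * Real.pi : ℝ) : ℂ) * Complex.I) = -1) :
    Odd m := by
  by_contra hm
  rw [Int.not_odd_iff_even] at hm
  obtain ⟨k, rfl⟩ := hm
  have h1 : Complex.exp ((((k + k : ℤ) * Real.pi : ℝ) : ℂ) * Complex.I) = 1 := by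
    rw [Complex.exp_eq_one_iff]
    exact ⟨k, by push_cast; ring⟩
  rw [h1] at h
  norm_num at h

/-- A subgroup with a nonzero invariant vector lies, as far as its rotations are concerned, in the
kernel of a character with odd frequencies. -/
lemma HasNonzeroInvariant.exists_character {S : Subgroup GG} (h : HasNonzeroInvariant S) :
    ∃ m n : ℤ, Odd m ∧ Odd n ∧ ∀ α β : ℝ, ((rot α, rot β) : GG) ∈ S →
      ∃ k : ℤ, m * α + n * β = 2 * Real.pi * k := by
  rw [hasNonzeroInvariant_iff] at h
  obtain ⟨φ, hm, h2, hS, h0⟩ := h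
  obtain ⟨c, hc0, hct, hmp⟩ := measurePreserving_torusCover
  have hpm := measurable_pull hm
  obtain ⟨F, hF⟩ : ∃ F : UnitAddTorus (Fin 2) → ℂ, F = fun t => (pull φ t : ℂ) := ⟨_, rfl⟩
  have hF2 : MemLp F 2 haarTorus := by
    rw [hF]
    refine ((h2.smul_measure hct).comp_measurePreserving hmp).mono
      (Complex.measurable_ofReal.comp hpm).aestronglyMeasurable
      (Filter.Eventually.of_forall fun t => ?_)
    simp only [Complex.norm_real, norm_pull]
    exact le_rfl
  have hF0 : ¬ F =ᵐ[haarTorus] 0 := by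
    intro hF0
    apply h0
    have h1 : ∀ᵐ t ∂haarTorus, φ (torusCover t) = 0 := by
      filter_upwards [hF0] with t ht
      rw [← norm_eq_zero, ← norm_pull]
      simpa [hF] using ht
    have hs : MeasurableSet {z | φ z = 0} := measurableSet_eq_fun hm measurable_const
    have h3 : ∀ᵐ z ∂(c • torusMeasure), φ z = 0 := by
      rw [← hmp.map_eq]
      exact (ae_map_iff hmp.measurable.aemeasurable hs).2 h1
    exact (Measure.absolutelyContinuous_smul hc0).ae_le h3
  -- One nonzero coefficient is enough: the half-period translations fix its parities, and each
  -- rotation in `S` must act trivially at this frequency.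
  obtain ⟨n, hn⟩ := exists_mFourierCoeff_ne_zero hF2 hF0
  refine ⟨n 0, n 1, ?_, ?_, fun α β hαβ => ?_⟩
  · apply odd_of_exp_eq_neg_one
    have := mFourier_eq_of_translate (a := shift Real.pi 0) (z := -1)
      (Filter.Eventually.of_forall fun t => by simp [hF, pull_add_pi_left]) hn
    rw [← this, mFourier_shift]
    simp
  · apply odd_of_exp_eq_neg_one
    have := mFourier_eq_of_translate (a := shift 0 Real.pi) (z := -1)
      (Filter.Eventually.of_forall fun t => by simp [hF, pull_add_pi_right]) hn
    rw [← this, mFourier_shift]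
    simp
  · have hinv : ∀ᵐ t ∂haarTorus, dualAction (rot α, rot β) φ (torusCover t) = φ (torusCover t) := by
      have h3 : ∀ᵐ z ∂(c • torusMeasure), dualAction (rot α, rot β) φ z = φ z :=
        (Measure.smul_absolutelyContinuous (c := c)).ae_le (hS _ hαβ)
      exact hmp.quasiMeasurePreserving.ae h3
    have := mFourier_eq_of_translate (F := F) (a := shift α β) (z := 1) (by
      filter_upwards [hinv] with t ht
      simp only [hF, one_mul, ← pull_dualAction_rot]
      rw [pull, ht, pull]) hn
    rw [mFourier_shift, Complex.exp_eq_one_iff] at this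
    obtain ⟨k, hk⟩ := this
    refine ⟨k, ?_⟩
    have h4 : ((n 0 * α + n 1 * β : ℝ) : ℂ) = ((2 * Real.pi * k : ℝ) : ℂ) := by
      apply mul_right_cancel₀ Complex.I_ne_zero
      rw [hk]
      push_cast
      ring
    exact_mod_cast h4

/-! ### Invariant vectors from characters -/

/-- The unit complex number spanning the line with coordinate `x`. -/
def unitVec (x : ProjLine) : ℂ :=
  (homCoord x 0 + homCoord x 1 * Complex.I) / (√(normSq (homCoord x)) : ℝ)

lemma norm_unitVec (x : ProjLine) : ‖unitVec x‖ = 1 := by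
  have h := normSq_pos (homCoord_ne_zero x)
  rw [unitVec, norm_div, Complex.norm_add_mul_I, Complex.norm_real, Real.norm_eq_abs,
    abs_of_pos (Real.sqrt_pos.2 h), show homCoord x 0 ^ 2 + homCoord x 1 ^ 2 = normSq (homCoord x) by
      rw [normSq, add_comm], div_self (Real.sqrt_pos.2 h).ne']

lemma measurable_unitVec : Measurable unitVec := by
  have h0 : Measurable fun x : ProjLine => ((homCoord x 0 : ℝ) : ℂ) :=
    Complex.measurable_ofReal.comp ((measurable_pi_apply 0).comp measurable_homCoord)
  have h1 : Measurable fun x : ProjLine => ((homCoord x 1 : ℝ) : ℂ) :=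
    Complex.measurable_ofReal.comp ((measurable_pi_apply 1).comp measurable_homCoord)
  exact (h0.add (h1.mul_const _)).div
    (Complex.measurable_ofReal.comp (measurable_normSq.comp measurable_homCoord).sqrt)

/-- Under `(x₁, x₂) ↦ x₁ + i x₂` the right action of `R(α)` is multiplication by `e^{iα}`; the sign
compares the rotated unit vector with the chosen unit vector over the image point. -/
lemma sFactor_mul_unitVec (α : ℝ) (x : ProjLine) :
    (sFactor (rot α) x : ℂ) * unitVec (moveRight (rot α) x) =
      unitVec x * Complex.exp (α * Complex.I) := by
  have hv := vecMul_homCoord (rot α) x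
  have hk : kFactor (rot α) x = 1 := kFactor_rot α x
  have hr := scale_ne_zero (rot α) x
  rw [kFactor_eq_scale, Real.sqrt_eq_one,
    div_eq_one_iff_eq (normSq_pos (homCoord_ne_zero x)).ne'] at hk
  rw [vecMul_rot] at hv
  have hy := normSq_pos (homCoord_ne_zero (moveRight (rot α) x))
  have e0 := congrFun hv 0
  have e1 := congrFun hv 1
  simp only [Matrix.cons_val_zero, Matrix.cons_val_one, Pi.smul_apply, smul_eq_mul] at e0 e1
  have hq : √(normSq (homCoord x)) =
      |scale (rot α) x| * √(normSq (homCoord (moveRight (rot α) x))) := by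
    rw [← hk, Real.sqrt_mul (sq_nonneg _), Real.sqrt_sq_eq_abs]
  have hw : (√(normSq (homCoord (moveRight (rot α) x))) : ℂ) ≠ 0 := by
    exact_mod_cast (Real.sqrt_pos.2 hy).ne'
  have ha : ((|scale (rot α) x| : ℝ) : ℂ) ≠ 0 := by
    exact_mod_cast abs_ne_zero.2 hr
  rw [unitVec, unitVec, hq, sFactor_eq, Complex.exp_mul_I]
  have c0 : (homCoord x 0 : ℂ) * Complex.cos α - homCoord x 1 * Complex.sin α =
      scale (rot α) x * homCoord (moveRight (rot α) x) 0 := by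
    exact_mod_cast congrArg (fun r : ℝ => (r : ℂ)) e0
  have c1 : (homCoord x 0 : ℂ) * Complex.sin α + homCoord x 1 * Complex.cos α =
      scale (rot α) x * homCoord (moveRight (rot α) x) 1 := by
    exact_mod_cast congrArg (fun r : ℝ => (r : ℂ)) e1
  push_cast
  rw [div_mul_div_comm, div_mul_eq_mul_div]
  congr 1
  linear_combination -c0 - Complex.I * c1 - homCoord x 1 * Complex.sin α * Complex.I_sq

lemma sFactor_zpow {m : ℤ} (hm : Odd m) (g : SL(2, ℝ)) (x : ProjLine) :
    (sFactor g x : ℂ) ^ m = sFactor g x := by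
  have h : sFactor g x = 1 ∨ sFactor g x = -1 := by
    have := abs_sFactor g x
    rcases abs_eq (show (0 : ℝ) ≤ 1 by norm_num) |>.1 this with h | h
    · exact Or.inl h
    · exact Or.inr h
  rcases h with h | h
  · rw [h]
    simp
  · rw [h]
    push_cast
    exact hm.neg_one_zpow

/-- The complex character vector with frequencies `m, n`. -/
def charVec (m n : ℤ) (z : Torus) : ℂ := unitVec z.1 ^ m * unitVec z.2 ^ n

lemma norm_charVec (m n : ℤ) (z : Torus) : ‖charVec m n z‖ = 1 := by
  simp [charVec, norm_unitVec]

lemma measurable_charVec (m n : ℤ) : Measurable (charVec m n) :=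
  ((measurable_unitVec.comp measurable_fst).pow_const m).mul
    ((measurable_unitVec.comp measurable_snd).pow_const n)

lemma sFactor_mul_charVec {m n : ℤ} (hm : Odd m) (hn : Odd n) {α β : ℝ} {k : ℤ}
    (h : m * α + n * β = 2 * Real.pi * k) (z : Torus) :
    ((sFactor (rot α) z.1 * sFactor (rot β) z.2 : ℝ) : ℂ) *
      charVec m n (moveRight (rot α) z.1, moveRight (rot β) z.2) = charVec m n z := by
  have he : Complex.exp (α * Complex.I) ^ m * Complex.exp (β * Complex.I) ^ n = 1 := by
    rw [← Complex.exp_int_mul, ← Complex.exp_int_mul, ← Complex.exp_add, Complex.exp_eq_one_iff]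
    refine ⟨k, ?_⟩
    have : (m * α + n * β : ℂ) = 2 * Real.pi * k := by exact_mod_cast h
    linear_combination Complex.I * this
  calc ((sFactor (rot α) z.1 * sFactor (rot β) z.2 : ℝ) : ℂ) *
        charVec m n (moveRight (rot α) z.1, moveRight (rot β) z.2)
      = (sFactor (rot α) z.1 * unitVec (moveRight (rot α) z.1)) ^ m *
          (sFactor (rot β) z.2 * unitVec (moveRight (rot β) z.2)) ^ n := by
        rw [mul_zpow, mul_zpow, sFactor_zpow hm, sFactor_zpow hn, charVec]
        push_cast
        ring
    _ = charVec m n z := by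
        rw [sFactor_mul_unitVec, sFactor_mul_unitVec, mul_zpow, mul_zpow, charVec]
        linear_combination unitVec z.1 ^ m * unitVec z.2 ^ n * he

/-- A group of rotations in the kernel of a character with odd frequencies has a nonzero invariant
vector. -/
lemma hasNonzeroInvariant_of_character {S : Subgroup GG} {m n : ℤ} (hm : Odd m) (hn : Odd n)
    (hS : ∀ s ∈ S, ∃ (α β : ℝ) (k : ℤ), s = (rot α, rot β) ∧ m * α + n * β = 2 * Real.pi * k) :
    HasNonzeroInvariant S := by
  have key : ∀ L : ℂ → ℝ, Measurable L → (∀ z, |L z| ≤ ‖z‖) →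
      (∀ (r : ℝ) (z : ℂ), L (r * z) = r * L z) →
      ¬ (fun z => L (charVec m n z)) =ᵐ[torusMeasure] 0 → HasNonzeroInvariant S := by
    intro L hLm hLb hLr hL0
    rw [hasNonzeroInvariant_iff]
    have hmeas : Measurable fun z => L (charVec m n z) := hLm.comp (measurable_charVec m n)
    refine ⟨_, hmeas, ?_, ?_, hL0⟩
    · refine MemLp.of_bound hmeas.aestronglyMeasurable 1 (Filter.Eventually.of_forall fun z => ?_)
      rw [Real.norm_eq_abs, ← norm_charVec m n z]
      exact hLb _
    · intro s hs
      obtain ⟨α, β, k, rfl, hk⟩ := hS s hs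
      refine Filter.Eventually.of_forall fun z => ?_
      have h1 := sFactor_mul_charVec hm hn hk z
      simp only [dualAction, kFactor_rot, one_pow, inv_one, one_mul]
      rw [← hLr, h1]
  -- A real vector is required. The complex one has modulus one, so its real and imaginary parts
  -- cannot both vanish almost everywhere.
  by_contra hno
  have hre := mt (key Complex.re Complex.measurable_re Complex.abs_re_le_norm (by simp)) hno
  have him := mt (key Complex.im Complex.measurable_im Complex.abs_im_le_norm (by simp)) hno
  rw [not_not] at hre him
  have hfalse : ∀ᵐ z ∂torusMeasure, False := by
    filter_upwards [hre, him] with z h1 h2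
    have h3 : charVec m n z = 0 := Complex.ext h1 h2
    have h4 := norm_charVec m n z
    rw [h3] at h4
    simp at h4
  rw [ae_iff] at hfalse
  simp only [not_false_eq_true] at hfalse
  exact torusMeasure_ne_zero (Measure.measure_univ_eq_zero.1 hfalse)

/-! ### Closed subgroups of `SO(2) × SO(2)` -/

lemma rot_eq_rot_iff {α β : ℝ} : rot α = rot β ↔ ∃ k : ℤ, α = β + 2 * Real.pi * k := by
  constructor
  · intro h
    have h0 : Real.cos α = Real.cos β := by
      simpa [rot] using congrArg (fun g : SL(2, ℝ) => g 0 0) h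
    have h1 : Real.sin α = Real.sin β := by
      simpa [rot] using congrArg (fun g : SL(2, ℝ) => g 0 1) h
    have h2 : (α : Real.Angle) = β := Real.Angle.cos_sin_inj h0 h1
    obtain ⟨k, hk⟩ := Real.Angle.angle_eq_iff_two_pi_dvd_sub.1 h2
    exact ⟨k, by linarith⟩
  · rintro ⟨k, rfl⟩
    have h0 : Real.cos (β + 2 * Real.pi * k) = Real.cos β := by
      rw [mul_comm _ (k : ℝ)]
      exact Real.cos_add_int_mul_two_pi β k
    have h1 : Real.sin (β + 2 * Real.pi * k) = Real.sin β := by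
      rw [mul_comm _ (k : ℝ)]
      exact Real.sin_add_int_mul_two_pi β k
    ext i j
    fin_cases i <;> fin_cases j <;> simp [rot, h0, h1]

lemma rot_mem_SO2 (θ : ℝ) : rot θ ∈ SO2 := by
  change (rot θ : Matrix (Fin 2) (Fin 2) ℝ) ∈ Matrix.orthogonalGroup (Fin 2) ℝ
  rw [Matrix.mem_orthogonalGroup_iff]
  have := Real.sin_sq_add_cos_sq θ
  ext i j
  rw [Matrix.mul_apply, Fin.sum_univ_two]
  fin_cases i <;> fin_cases j <;> simp [rot] <;> linarith

lemma exists_eq_rot {g : SL(2, ℝ)} (hg : g ∈ SO2) : ∃ θ, g = rot θ := by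
  have h : (g : Matrix (Fin 2) (Fin 2) ℝ) ∈ Matrix.orthogonalGroup (Fin 2) ℝ := hg
  rw [Matrix.mem_orthogonalGroup_iff] at h
  have h00 := congrFun (congrFun h 0) 0
  have h01 := congrFun (congrFun h 0) 1
  rw [Matrix.mul_apply, Fin.sum_univ_two] at h00 h01
  simp at h00 h01
  have hdet := det_expand g
  have e10 : g 1 0 = -g 0 1 := by
    linear_combination g 0 0 * h01 - g 0 1 * hdet - g 1 0 * h00
  have e11 : g 1 1 = g 0 0 := by
    linear_combination g 0 1 * h01 + g 0 0 * hdet - g 1 1 * h00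
  obtain ⟨z, hz0', hz1'⟩ : ∃ z : ℂ, z.re = g 0 0 ∧ z.im = g 0 1 := ⟨⟨g 0 0, g 0 1⟩, rfl, rfl⟩
  have hn : ‖z‖ = 1 := by
    rw [Complex.norm_eq_sqrt_sq_add_sq, Real.sqrt_eq_one]
    rw [hz0', hz1']
    linarith
  have hz0 : z ≠ 0 := by
    intro h0
    rw [h0] at hn
    simp at hn
  have hc := Complex.cos_arg hz0
  have hs := Complex.sin_arg z
  rw [hn, div_one, hz0'] at hc
  rw [hn, div_one, hz1'] at hs
  refine ⟨z.arg, ?_⟩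
  ext i j
  fin_cases i <;> fin_cases j <;> simp [rot, hc, hs, e10, e11]

lemma continuous_rot : Continuous rot := by
  refine Continuous.subtype_mk ?_ _
  refine continuous_matrix fun i j => ?_
  fin_cases i <;> fin_cases j <;> simp <;> fun_prop

lemma rot_int_mul (n : ℤ) (α : ℝ) : rot (n * α) = rot α ^ n := by
  have h := map_zsmul (AddMonoidHom.mk' (fun x : ℝ => Additive.ofMul (rot x))
    (fun x y => congrArg Additive.ofMul (rot_add x y))) n α
  simpa using congrArg Additive.toMul h

/-- `H(N,q,p)` as the kernel of a character, when `q` divides `N`. -/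
lemma mem_H_mul_iff {M : ℕ} {q p : ℤ} (hM : M ≠ 0) (hq : q ≠ 0) {α β : ℝ} :
    ((rot α, rot β) : GG) ∈ H (M * q.natAbs) q p ↔
      ∃ j : ℤ, M * (p * α - q * β) = 2 * Real.pi * j := by
  have hpi := Real.pi_pos
  have hM' : (M : ℝ) ≠ 0 := by exact_mod_cast hM
  have hq' : (q : ℝ) ≠ 0 := by exact_mod_cast hq
  have ha : ((M * q.natAbs : ℕ) : ℝ) = M * |(q : ℝ)| := by
    push_cast
    rw [Nat.cast_natAbs, Int.cast_abs]
  obtain ⟨ε, hε, hεq⟩ : ∃ ε : ℤ, ε * ε = 1 ∧ |(q : ℝ)| = ε * q := by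
    rcases abs_choice (q : ℝ) with h | h
    · exact ⟨1, by norm_num, by simp [h]⟩
    · exact ⟨-1, by norm_num, by simp [h]⟩
  have hε' : (ε : ℝ) * ε = 1 := by exact_mod_cast hε
  have hε0 : (ε : ℝ) ≠ 0 := left_ne_zero_of_mul_eq_one hε'
  constructor
  · rintro ⟨θ, i, h⟩
    rw [Prod.mk.injEq, rot_eq_rot_iff, rot_eq_rot_iff] at h
    obtain ⟨⟨k, hk⟩, l, hl⟩ := h
    refine ⟨M * (p * k - q * l) - ε * i, ?_⟩
    rw [hk, hl, ha, hεq]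
    push_cast
    field_simp
    linear_combination 2 * Real.pi * i * hε'
  · rintro ⟨j, hj⟩
    -- Choosing `θ = α / q` makes the first angle exact. The defect in the second is `-2πj / (M q)`,
    -- a multiple of `2π / (M|q|)`; this is why the factor `|q|` is needed.
    refine ⟨α / q, -ε * j, ?_⟩
    rw [ha, hεq]
    congr 2
    · field_simp
    · push_cast
      field_simp
      linear_combination (-(1 : ℝ)) * hj

/-- The frequencies of a character in reduced form. -/
lemma exists_reduced_frequencies {m n : ℤ} (hm : Odd m) (hn : Odd n) :
    ∃ (d : ℕ) (q p : ℤ) (ε : ℤ), Odd d ∧ Odd q ∧ Odd p ∧ IsCoprime q p ∧ 0 < p ∧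
      d * p = ε * m ∧ d * q = -(ε * n) := by
  have hm0 : m ≠ 0 := by
    rintro rfl
    simp at hm
  obtain ⟨m', n', hg, hm', hn'⟩ := Int.exists_gcd_one (Int.gcd_pos_of_ne_zero_left n hm0)
  set d := Int.gcd m n
  have hdm : Odd m' ∧ Odd (d : ℤ) := by
    rw [hm', Int.odd_mul] at hm
    exact hm
  have hn'o : Odd n' := by
    rw [hn', Int.odd_mul] at hn
    exact hn.1
  have hc : IsCoprime n' m' := (Int.isCoprime_iff_gcd_eq_one.2 hg).symm
  have hd : Odd d := by exact_mod_cast hdm.2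
  have hm'0 : m' ≠ 0 := by
    rintro rfl
    simp at hm'
    exact hm0 hm'
  rcases lt_or_gt_of_ne hm'0 with h | h
  · refine ⟨d, n', -m', -1, hd, hn'o, hdm.1.neg, hc.neg_right, by linarith, ?_, ?_⟩ <;> linarith
  · refine ⟨d, -n', m', 1, hd, hn'o.neg, hdm.1, hc.neg_left, h, ?_, ?_⟩ <;> linarith

/-- An infinite closed group of rotations in the kernel of a character contains the identity
component of the kernel. -/
lemma mem_of_infinite_of_character {S : Subgroup GG} (hK : S ≤ KK)
    (hcl : IsClosed (S : Set GG)) (hinf : (S : Set GG).Infinite) {d : ℕ} {q p : ℤ} (hd : d ≠ 0)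
    (hq : q ≠ 0) (hqp : IsCoprime q p)
    (hS : ∀ α β : ℝ, ((rot α, rot β) : GG) ∈ S → ∃ k : ℤ, d * (p * α - q * β) = 2 * Real.pi * k)
    (θ : ℝ) : ((rot (q * θ), rot (p * θ)) : GG) ∈ S := by
  have hpi := Real.pi_pos
  have hd' : (d : ℝ) ≠ 0 := by exact_mod_cast hd
  have hq' : (q : ℝ) ≠ 0 := by exact_mod_cast hq
  let L : AddSubgroup ℝ :=
    { carrier := {θ | ((rot (q * θ), rot (p * θ)) : GG) ∈ S}
      zero_mem' := by
        simp [rot_zero, ← Prod.one_eq_mk, one_mem S]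
      add_mem' := by
        intro x y hx hy
        have := mul_mem (show ((rot (q * x), rot (p * x)) : GG) ∈ S from hx) hy
        rw [Prod.mk_mul_mk, ← rot_add, ← rot_add, ← mul_add, ← mul_add] at this
        exact this
      neg_mem' := by
        intro x hx
        have := inv_mem (show ((rot (q * x), rot (p * x)) : GG) ∈ S from hx)
        rw [Prod.inv_mk, ← rot_neg, ← rot_neg, ← mul_neg, ← mul_neg] at this
        exact this }
  have hLc : IsClosed (L : Set ℝ) := by
    have h : Continuous fun θ : ℝ => ((rot (q * θ), rot (p * θ)) : GG) :=
      (continuous_rot.comp (by fun_prop)).prodMk (continuous_rot.comp (by fun_prop))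
    exact hcl.preimage h
  -- A closed subgroup of `ℝ` is everything or cyclic. In the cyclic case the angles of `S` turn out
  -- to be multiples of `a / d`, so `S` would be finite.
  rcases L.dense_or_cyclic with hdense | ⟨a, ha⟩
  · have : (L : Set ℝ) = Set.univ := by rw [← hLc.closure_eq, hdense.closure_eq]
    exact (Set.eq_univ_iff_forall.1 this) θ
  · exfalso
    have hrot2 : ∀ n : ℤ, rot (2 * Real.pi * n) = 1 := by
      intro n
      rw [← rot_zero]
      exact rot_eq_rot_iff.2 ⟨n, by ring⟩
    have hmemL : ∀ x, x ∈ L ↔ ∃ k : ℤ, x = k * a := by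
      intro x
      rw [ha, AddSubgroup.mem_closure_singleton]
      simp only [zsmul_eq_mul, eq_comm]
    have h2pi : 2 * Real.pi ∈ L := by
      change ((rot (q * (2 * Real.pi)), rot (p * (2 * Real.pi))) : GG) ∈ S
      rw [mul_comm, mul_comm (p : ℝ), hrot2, hrot2]
      exact one_mem S
    obtain ⟨K, hK2⟩ := (hmemL _).1 h2pi
    have hK0 : K ≠ 0 := by
      rintro rfl
      simp at hK2
    have hangle : ∀ s ∈ S, ∃ i j : ℤ, s = (rot (i * (a / d)), rot (j * (a / d))) := by
      intro s hs
      obtain ⟨α, hα⟩ := exists_eq_rot (hK hs).1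
      obtain ⟨β, hβ⟩ := exists_eq_rot (hK hs).2
      have hsαβ : s = (rot α, rot β) := Prod.ext hα hβ
      obtain ⟨j, hj⟩ := hS α β (hsαβ ▸ hs)
      obtain ⟨v, u, huv⟩ := hqp
      have huv' : (v : ℝ) * q + u * p = 1 := by exact_mod_cast huv
      -- The `d`-th power of `s` lies on the circle `(q θ, p θ)`; the Bézout coefficients correct
      -- its two angles by multiples of `2π` so that they share one `θ`.
      have hθ : (d * α - 2 * Real.pi * (j * u : ℤ)) / q ∈ L := by
        have e1 : q * ((d * α - 2 * Real.pi * (j * u : ℤ)) / q) =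
            (d : ℤ) * α + 2 * Real.pi * (-(j * u) : ℤ) := by
          push_cast
          field_simp
          ring
        have e2 : p * ((d * α - 2 * Real.pi * (j * u : ℤ)) / q) =
            (d : ℤ) * β + 2 * Real.pi * (j * v : ℤ) := by
          push_cast
          field_simp
          linear_combination hj - 2 * Real.pi * j * huv'
        change ((rot (q * _), rot (p * _)) : GG) ∈ S
        rw [e1, e2, rot_add, rot_add, hrot2, hrot2, mul_one, mul_one, rot_int_mul, rot_int_mul]
        have := zpow_mem hs (d : ℤ)
        rw [hsαβ] at this
        exact this
      obtain ⟨l, hl⟩ := (hmemL _).1 hθ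
      rw [div_eq_iff hq'] at hl
      refine ⟨l * q + K * (j * u), p * l - K * (j * v), ?_⟩
      rw [hsαβ]
      congr 2
      · push_cast at hl ⊢
        field_simp
        linear_combination hl + (j * u) * hK2
      · push_cast at hl ⊢
        field_simp
        apply mul_left_cancel₀ hq'
        linear_combination (p : ℝ) * hl - hj - q * j * v * hK2 + 2 * Real.pi * j * huv'
    have hper : ∀ i : ℤ, rot (i * (a / d)) = rot ((i % (K * d) : ℤ) * (a / d)) := by
      intro i
      rw [rot_eq_rot_iff]
      refine ⟨i / (K * d), ?_⟩
      have h1 : (i : ℝ) = (i % (K * d) : ℤ) + K * d * (i / (K * d) : ℤ) := by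
        exact_mod_cast (Int.emod_add_mul_ediv i (K * d)).symm
      rw [hK2]
      nth_rewrite 1 [h1]
      field_simp
    have hKd : K * d ≠ 0 := mul_ne_zero hK0 (by exact_mod_cast hd)
    apply hinf
    refine (((Set.finite_Ico (0 : ℤ) |K * d|).prod (Set.finite_Ico (0 : ℤ) |K * d|)).image
      fun ij : ℤ × ℤ => ((rot (ij.1 * (a / d)), rot (ij.2 * (a / d))) : GG)).subset ?_
    intro s hs
    obtain ⟨i, j, hij⟩ := hangle s hs
    refine ⟨(i % (K * d), j % (K * d)), ⟨⟨Int.emod_nonneg _ hKd, Int.emod_lt_abs _ hKd⟩,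
      Int.emod_nonneg _ hKd, Int.emod_lt_abs _ hKd⟩, ?_⟩
    rw [hij, hper i, hper j]

/-- Classification of the infinite closed groups of rotations in the kernel of a character with odd
frequencies. -/
lemma exists_eq_H_of_character {S : Subgroup GG} (hK : S ≤ KK) (hcl : IsClosed (S : Set GG))
    (hinf : (S : Set GG).Infinite) {m n : ℤ} (hm : Odd m) (hn : Odd n)
    (hS : ∀ α β : ℝ, ((rot α, rot β) : GG) ∈ S → ∃ k : ℤ, m * α + n * β = 2 * Real.pi * k) :
    ∃ (N : ℕ) (q p : ℤ), Admissible N q p ∧ S = H N q p := by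
  have hpi := Real.pi_pos
  obtain ⟨d, q, p, ε, hd, hq, hp, hqp, hp0, e1, e2⟩ := exists_reduced_frequencies hm hn
  have hd0 : d ≠ 0 := by
    rintro rfl
    simp at hd
  have hq0 : q ≠ 0 := by
    rintro rfl
    simp at hq
  have hd' : (d : ℝ) ≠ 0 := by exact_mod_cast hd0
  have hq' : (q : ℝ) ≠ 0 := by exact_mod_cast hq0
  have e1' : (d : ℝ) * p = ε * m := by exact_mod_cast e1
  have e2' : (d : ℝ) * q = -(ε * n) := by exact_mod_cast e2
  have hSd : ∀ α β : ℝ, ((rot α, rot β) : GG) ∈ S →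
      ∃ k : ℤ, d * (p * α - q * β) = 2 * Real.pi * k := by
    intro α β h
    obtain ⟨k, hk⟩ := hS α β h
    refine ⟨ε * k, ?_⟩
    push_cast
    linear_combination ε * hk + α * e1' - β * e2'
  have hcirc := mem_of_infinite_of_character hK hcl hinf hd0 hq0 hqp hSd
  -- These integers label the components of the kernel that meet `S`.
  let J : AddSubgroup ℤ :=
    { carrier := {j | ∃ α β : ℝ, ((rot α, rot β) : GG) ∈ S ∧
        d * (p * α - q * β) = 2 * Real.pi * j}
      zero_mem' := ⟨0, 0, by simp [rot_zero, ← Prod.one_eq_mk, one_mem S], by simp⟩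
      add_mem' := by
        rintro i j ⟨α, β, h, hi⟩ ⟨α', β', h', hj⟩
        refine ⟨α + α', β + β', ?_, by push_cast; linear_combination hi + hj⟩
        have := mul_mem h h'
        rwa [Prod.mk_mul_mk, ← rot_add, ← rot_add] at this
      neg_mem' := by
        rintro i ⟨α, β, h, hi⟩
        refine ⟨-α, -β, ?_, by push_cast; linear_combination -hi⟩
        have := inv_mem h
        rwa [Prod.inv_mk, ← rot_neg, ← rot_neg] at this }
  have hdJ : (d : ℤ) ∈ J := by
    obtain ⟨v, u, huv⟩ := hqp
    have huv' : (v : ℝ) * q + u * p = 1 := by exact_mod_cast huv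
    -- The identity element, written with angles that give `p α - q β` the value `2π`.
    refine ⟨2 * Real.pi * u, 2 * Real.pi * (-v : ℤ), ?_, ?_⟩
    · have hrot2 : ∀ n : ℤ, rot (2 * Real.pi * n) = 1 := by
        intro n
        rw [← rot_zero]
        exact rot_eq_rot_iff.2 ⟨n, by ring⟩
      rw [hrot2, hrot2]
      exact one_mem S
    · push_cast
      linear_combination 2 * Real.pi * d * huv'
  obtain ⟨k, hk⟩ := Int.subgroup_cyclic J
  have hmemJ : ∀ j, j ∈ J ↔ ∃ l : ℤ, j = l * k := by
    intro x
    rw [hk, AddSubgroup.mem_closure_singleton]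
    simp only [zsmul_eq_mul, eq_comm, Int.cast_id]
  obtain ⟨M₀, hM₀⟩ := (hmemJ _).1 hdJ
  have hM₀' : (d : ℝ) = M₀ * k := by exact_mod_cast hM₀
  have hk0 : (k : ℝ) ≠ 0 := by
    intro h
    rw [h, mul_zero] at hM₀'
    exact hd' hM₀'
  have hM₀o : Odd M₀ := by
    have : Odd (d : ℤ) := by exact_mod_cast hd
    rw [hM₀, Int.odd_mul] at this
    exact this.1
  have hM0 : M₀.natAbs ≠ 0 := by
    intro h
    rw [Int.natAbs_eq_zero] at h
    rw [h] at hM₀o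
    simp at hM₀o
  obtain ⟨σ, hσ, hσM⟩ : ∃ σ : ℤ, σ * σ = 1 ∧ ((M₀.natAbs : ℕ) : ℝ) = σ * M₀ := by
    rw [Nat.cast_natAbs, Int.cast_abs]
    rcases abs_choice (M₀ : ℝ) with h | h
    · exact ⟨1, by norm_num, by simp [h]⟩
    · exact ⟨-1, by norm_num, by simp [h]⟩
  have hσ' : (σ : ℝ) * σ = 1 := by exact_mod_cast hσ
  refine ⟨M₀.natAbs * q.natAbs, q, p, ⟨?_, hq, hp, hqp, hp0⟩, ?_⟩
  · exact (Int.natAbs_odd.2 hM₀o).mul (Int.natAbs_odd.2 hq)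
  · ext s
    constructor
    · intro hs
      obtain ⟨α, hα⟩ := exists_eq_rot (hK hs).1
      obtain ⟨β, hβ⟩ := exists_eq_rot (hK hs).2
      have hsαβ : s = (rot α, rot β) := Prod.ext hα hβ
      rw [hsαβ] at hs ⊢
      rw [mem_H_mul_iff hM0 hq0, hσM]
      obtain ⟨j, hj⟩ := hSd α β hs
      obtain ⟨l, hl⟩ := (hmemJ j).1 ⟨α, β, hs, hj⟩
      refine ⟨σ * l, ?_⟩
      rw [hl, hM₀'] at hj
      apply mul_right_cancel₀ hk0
      push_cast at hj ⊢
      linear_combination σ * hj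
    · intro hs
      obtain ⟨α, β, hsαβ⟩ : ∃ α β, s = (rot α, rot β) := by
        obtain ⟨θ, i, h⟩ := hs
        exact ⟨_, _, h⟩
      rw [hsαβ] at hs ⊢
      rw [mem_H_mul_iff hM0 hq0, hσM] at hs
      obtain ⟨j, hj⟩ := hs
      obtain ⟨α', β', h', hj'⟩ := (hmemJ (σ * j * k)).2 ⟨σ * j, rfl⟩
      -- An element of `S` with the same label differs from the given one by a point of the circle
      -- already known to lie in `S`.
      have h1 := hcirc ((α - α') / q)
      have e3 : q * ((α - α') / q) = α - α' := by field_simp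
      have e4 : p * ((α - α') / q) = β - β' := by
        field_simp
        apply mul_left_cancel₀ hd'
        push_cast at hj'
        linear_combination σ * k * hj - hj' + (p * α - q * β) * (hM₀' - M₀ * k * hσ')
      rw [e3, e4] at h1
      have h2 := mul_mem h1 h'
      rwa [Prod.mk_mul_mk, ← rot_add, ← rot_add, sub_add_cancel, sub_add_cancel] at h2

/-! ### The groups `H(N,q,p)` -/

lemma H_le_KK (N : ℕ) (q p : ℤ) : H N q p ≤ KK := by
  rintro _ ⟨θ, i, rfl⟩
  exact ⟨rot_mem_SO2 _, rot_mem_SO2 _⟩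

/-- By periodicity `θ ∈ [0, 2π]` and `0 ≤ i < N` suffice, so the group is a continuous image of a
compact set. -/
lemma isClosed_H {N : ℕ} (hN : N ≠ 0) (q p : ℤ) : IsClosed (H N q p : Set GG) := by
  have hN' : (N : ℝ) ≠ 0 := by exact_mod_cast hN
  have hNz : (N : ℤ) ≠ 0 := by exact_mod_cast hN
  have hpi := Real.pi_pos
  set f : ℝ × ℤ → GG := fun x => (rot (q * x.1), rot (p * x.1 + 2 * Real.pi / N * x.2)) with hf
  have hfc : Continuous f := by
    have h : Continuous fun i : ℤ => (i : ℝ) := continuous_of_discreteTopology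
    exact (continuous_rot.comp (by fun_prop)).prodMk (continuous_rot.comp (by fun_prop))
  have himg : (H N q p : Set GG) = f '' (Set.Icc 0 (2 * Real.pi) ×ˢ Set.Ico 0 (N : ℤ)) := by
    ext s
    constructor
    · rintro ⟨θ, i, rfl⟩
      have h2 : 0 < 2 * Real.pi := by positivity
      set m : ℤ := ⌊θ / (2 * Real.pi)⌋ with hm
      have hm1 : m * (2 * Real.pi) ≤ θ := by
        rw [← le_div_iff₀ h2]
        exact Int.floor_le _
      have hm2 : θ ≤ (m + 1) * (2 * Real.pi) := by
        rw [← div_le_iff₀ h2]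
        exact (Int.lt_floor_add_one _).le
      refine ⟨(θ - m * (2 * Real.pi), i % N), ⟨⟨by linarith, by linarith⟩, Int.emod_nonneg _ hNz,
        Int.emod_lt_of_pos _ (by positivity)⟩, ?_⟩
      have h1 : (i : ℝ) = (i % N : ℤ) + N * (i / N : ℤ) := by
        exact_mod_cast (Int.emod_add_mul_ediv i N).symm
      simp only [hf]
      rw [Prod.mk.injEq, rot_eq_rot_iff, rot_eq_rot_iff]
      refine ⟨⟨-(q * m), by push_cast; ring⟩, ⟨-(p * m) - i / N, ?_⟩⟩
      rw [h1]
      push_cast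
      field_simp
      ring
    · rintro ⟨x, -, rfl⟩
      exact ⟨x.1, x.2, rfl⟩
  rw [himg]
  exact ((isCompact_Icc.prod (Set.finite_Ico _ _).isCompact).image hfc).isClosed

/-- Taking `θ = n / q` makes the first component the rotation by `n` radians; these are distinct for
distinct `n` because `π` is irrational. -/
lemma infinite_H (N : ℕ) {q : ℤ} (p : ℤ) (hq : q ≠ 0) : (H N q p : Set GG).Infinite := by
  have hq' : (q : ℝ) ≠ 0 := by exact_mod_cast hq
  refine Set.infinite_of_injective_forall_mem
    (f := fun n : ℕ => ((rot (q * (n / q)), rot (p * (n / q) + 2 * Real.pi / N * (0 : ℤ))) : GG))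
    ?_ fun n => ⟨_, 0, rfl⟩
  intro n n' h
  have h1 := (Prod.mk.inj h).1
  rw [rot_eq_rot_iff, mul_div_cancel₀ _ hq', mul_div_cancel₀ _ hq'] at h1
  obtain ⟨k, hk⟩ := h1
  by_cases hk0 : k = 0
  · rw [hk0] at hk
    simpa using hk
  · exfalso
    have hk' : (k : ℝ) ≠ 0 := by exact_mod_cast hk0
    refine irrational_pi ⟨((n : ℚ) - n') / (2 * k), ?_⟩
    push_cast
    field_simp
    linarith

lemma hasNonzeroInvariant_H {N : ℕ} {q p : ℤ} (hN : Odd N) (hq : Odd q) (hp : Odd p) :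
    HasNonzeroInvariant (H N q p) := by
  have hN' : (N : ℝ) ≠ 0 := by
    have := hN.pos.ne'
    exact_mod_cast this
  have hNz : Odd (N : ℤ) := by exact_mod_cast hN
  -- The character `(N p, -N q)` kills the circle and takes the value `-2π q i` on the shift by `2πi
  -- / N`.
  refine hasNonzeroInvariant_of_character (hNz.mul hp) (hNz.mul hq).neg ?_
  rintro _ ⟨θ, i, rfl⟩
  refine ⟨_, _, -(q * i), rfl, ?_⟩
  push_cast
  field_simp
  ring

/-! ### The Lie algebra of `H(N,q,p)` -/

/-- The generator of the rotations. -/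
def genJ : Matrix (Fin 2) (Fin 2) ℝ := !![0, 1; -1, 0]

lemma genJ_mul_self : genJ * genJ = -1 := by
  ext i j
  fin_cases i <;> fin_cases j <;> simp [genJ]

attribute [local instance] Matrix.linftyOpNormedRing Matrix.linftyOpNormedAlgebra

/-- Since `genJ` squares to `-1`, it is the image of `i` under an algebra map from `ℂ`, which
carries Euler's formula over to matrices. -/
lemma exp_smul_genJ (t : ℝ) : NormedSpace.exp (t • genJ) = (rot t : Matrix (Fin 2) (Fin 2) ℝ) := by
  set f : ℂ →ₐ[ℝ] Matrix (Fin 2) (Fin 2) ℝ := Complex.lift ⟨genJ, genJ_mul_self⟩ with hf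
  have hc : Continuous f := f.toLinearMap.continuous_of_finiteDimensional
  have hfI : f Complex.I = genJ := by simp [hf]
  have h1 : f (t • Complex.I) = t • genJ := by rw [map_smul, hfI]
  have h3 : f (NormedSpace.exp (t • Complex.I)) = NormedSpace.exp (t • genJ) :=
    (NormedSpace.map_exp f hc _).trans (congrArg _ h1)
  rw [← h3]
  have h2 : NormedSpace.exp (t • Complex.I) =
      algebraMap ℝ ℂ (Real.cos t) + Real.sin t • Complex.I := by
    rw [← Complex.exp_eq_exp_ℂ, Complex.real_smul, Complex.exp_mul_I, Complex.real_smul]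
    simp
  rw [h2, map_add, map_smul, hfI, AlgHom.commutes]
  ext i j
  fin_cases i <;> fin_cases j <;> simp [rot, genJ, Algebra.algebraMap_eq_smul_one]

/-- A matrix whose one-parameter group consists of rotations is skew-symmetric. -/
lemma eq_smul_genJ_of_exp {X : Matrix (Fin 2) (Fin 2) ℝ}
    (h : ∀ t : ℝ, ∃ θ : ℝ, NormedSpace.exp (t • X) = (rot θ : Matrix (Fin 2) (Fin 2) ℝ)) :
    X = X 0 1 • genJ := by
  have hd : HasDerivAt (fun t : ℝ => NormedSpace.exp (t • X)) X 0 := by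
    have h0 := hasDerivAt_exp_smul_const (𝕂 := ℝ) X (0 : ℝ)
    rw [zero_smul, NormedSpace.exp_zero, one_mul] at h0
    exact h0
  have he : ∀ i j, HasDerivAt (fun t : ℝ => NormedSpace.exp (t • X) i j) (X i j) 0 := by
    intro i j
    let ℓ : Matrix (Fin 2) (Fin 2) ℝ →L[ℝ] ℝ :=
      LinearMap.toContinuousLinearMap (Matrix.entryLinearMap ℝ ℝ i j)
    exact ℓ.hasFDerivAt.comp_hasDerivAt (0 : ℝ) hd
  have z00 : NormedSpace.exp ((0 : ℝ) • X) 0 0 = 1 := by simp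
  have z01 : NormedSpace.exp ((0 : ℝ) • X) 0 1 = 0 := by simp
  have e1 : X 1 1 = X 0 0 := by
    refine (he 1 1).unique ?_
    convert! he 0 0 using 1
    funext t
    obtain ⟨θ, hθ⟩ := h t
    rw [hθ]
    simp [rot]
  have e2 : X 1 0 = -X 0 1 := by
    refine (he 1 0).unique ?_
    convert! (he 0 1).neg using 1
    funext t
    obtain ⟨θ, hθ⟩ := h t
    simp only [Pi.neg_apply]
    rw [hθ]
    simp [rot]
  -- Differentiate `cos² + sin² = 1` along the first row at `t = 0`.
  have e3 : X 0 0 = 0 := by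
    have h1 := ((he 0 0).pow 2).add ((he 0 1).pow 2)
    have h2 : HasDerivAt (fun _ : ℝ => (1 : ℝ)) 0 (0 : ℝ) := hasDerivAt_const _ _
    have h3 := h2.unique (f := fun _ : ℝ => (1 : ℝ)) (by
      convert! h1 using 1
      funext t
      obtain ⟨θ, hθ⟩ := h t
      simp only [Pi.add_apply, Pi.pow_apply]
      rw [hθ]
      simp [rot])
    rw [z00, z01] at h3
    norm_num at h3
    linarith
  ext i j
  fin_cases i <;> fin_cases j <;> simp [genJ, e1, e2, e3]

lemma lieAlg_H {N : ℕ} {q p : ℤ} (hN : N ≠ 0) (hp : p ≠ 0) :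
    lieAlg (H N q p) = {X | ∃ c : ℝ, c • ((q : ℝ) • genJ, (p : ℝ) • genJ) = X} := by
  have hpi := Real.pi_pos
  have hN' : (N : ℝ) ≠ 0 := by exact_mod_cast hN
  have hp' : (p : ℝ) ≠ 0 := by exact_mod_cast hp
  ext X
  constructor
  · intro hX
    have hX1 : X.1 = X.1 0 1 • genJ := eq_smul_genJ_of_exp fun t => by
      obtain ⟨_, ⟨θ, i, rfl⟩, h1, -⟩ := hX t
      exact ⟨_, h1.symm⟩
    have hX2 : X.2 = X.2 0 1 • genJ := eq_smul_genJ_of_exp fun t => by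
      obtain ⟨_, ⟨θ, i, rfl⟩, -, h2⟩ := hX t
      exact ⟨_, h2.symm⟩
    set a := X.1 0 1
    set b := X.2 0 1
    have hkey : ∀ t : ℝ, ∃ k : ℤ, t * (N * (p * a - q * b)) = 2 * Real.pi * k := by
      intro t
      obtain ⟨_, ⟨θ, i, rfl⟩, h1, h2⟩ := hX t
      rw [hX1, smul_smul, exp_smul_genJ] at h1
      rw [hX2, smul_smul, exp_smul_genJ] at h2
      obtain ⟨k, hk⟩ := rot_eq_rot_iff.1 (Subtype.ext h1)
      obtain ⟨l, hl⟩ := rot_eq_rot_iff.1 (Subtype.ext h2)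
      refine ⟨-(N * p * k) + N * q * l - q * i, ?_⟩
      push_cast
      field_simp at hl
      linear_combination (-(N : ℝ) * p) * hk + q * hl
    -- A linear function of `t` with values in `2πℤ` is zero: otherwise it would take the value `π`.
    have h0 : (N : ℝ) * (p * a - q * b) = 0 := by
      by_contra hne
      obtain ⟨k, hk⟩ := hkey (Real.pi / (N * (p * a - q * b)))
      rw [div_mul_cancel₀ _ hne] at hk
      have h1 : (1 : ℝ) = 2 * k := mul_left_cancel₀ hpi.ne' (by linarith)
      have h2 : (1 : ℤ) = 2 * k := by exact_mod_cast h1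
      omega
    have h1 : p * a = q * b := by
      have := (mul_eq_zero.1 h0).resolve_left hN'
      linarith
    refine ⟨b / p, ?_⟩
    apply Prod.ext
    · simp only [Prod.smul_fst]
      rw [hX1, smul_smul]
      congr 1
      field_simp
      linarith
    · simp only [Prod.smul_snd]
      rw [hX2, smul_smul]
      congr 1
      field_simp
  · rintro ⟨c, rfl⟩ t
    refine ⟨_, ⟨t * c, 0, rfl⟩, ?_, ?_⟩
    · simp only [Prod.smul_fst]
      rw [smul_smul, smul_smul, exp_smul_genJ]
      congr 2
      ring
    · simp only [Prod.smul_snd]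
      rw [smul_smul, smul_smul, exp_smul_genJ]
      congr 2
      push_cast
      ring

lemma lieDim_H {N : ℕ} {q p : ℤ} (hN : N ≠ 0) (hp : p ≠ 0) : lieDim (H N q p) = 1 := by
  have hp' : (p : ℝ) ≠ 0 := by exact_mod_cast hp
  have h : lieAlg (H N q p) =
      (Submodule.span ℝ {((q : ℝ) • genJ, (p : ℝ) • genJ)} : Set _) := by
    rw [lieAlg_H hN hp]
    ext X
    exact Submodule.mem_span_singleton.symm
  rw [lieDim, h, Submodule.span_eq]
  apply finrank_span_singleton
  intro h0
  have h1 := congrFun (congrFun (congrArg Prod.snd h0) 0) 1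
  simp [genJ] at h1
  exact hp h1

/-! ### Conjugation -/

lemma isClosed_map_conj {S : Subgroup GG} (h : IsClosed (S : Set GG)) (g : GG) :
    IsClosed ((S.map (MulAut.conj g).toMonoidHom : Subgroup GG) : Set GG) := by
  have : ((S.map (MulAut.conj g).toMonoidHom : Subgroup GG) : Set GG) =
      (fun x => g⁻¹ * x * g) ⁻¹' (S : Set GG) := by
    ext x
    constructor
    · rintro ⟨s, hs, rfl⟩
      simpa [mul_assoc] using hs
    · intro hx
      exact ⟨_, hx, by simp [mul_assoc]⟩
  rw [this]
  exact h.preimage (by fun_prop)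

lemma infinite_map_conj {S : Subgroup GG} (h : (S : Set GG).Infinite) (g : GG) :
    ((S.map (MulAut.conj g).toMonoidHom : Subgroup GG) : Set GG).Infinite := by
  rw [Subgroup.coe_map]
  exact h.image (MulAut.conj g).injective.injOn

lemma map_conj_inv_map_conj (S : Subgroup GG) (g : GG) :
    (S.map (MulAut.conj g).toMonoidHom).map (MulAut.conj g⁻¹).toMonoidHom = S := by
  rw [Subgroup.map_map]
  convert! Subgroup.map_id S
  ext x <;> simp [mul_assoc]

lemma infinite_le_KK_iff (S : Subgroup GG) :
    (S ≤ KK ∧ IsClosed (S : Set GG) ∧ (S : Set GG).Infinite ∧ HasNonzeroInvariant S) ↔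
      ∃ (N : ℕ) (q p : ℤ), Admissible N q p ∧ S = H N q p := by
  constructor
  · rintro ⟨hK, hcl, hinf, hinv⟩
    obtain ⟨m, n, hm, hn, hS⟩ := hinv.exists_character
    exact exists_eq_H_of_character hK hcl hinf hm hn hS
  · rintro ⟨N, q, p, ⟨hN, hq, hp, -, -⟩, rfl⟩
    have hq0 : q ≠ 0 := by
      rintro rfl
      simp at hq
    exact ⟨H_le_KK N q p, isClosed_H hN.pos.ne' q p, infinite_H N p hq0,
      hasNonzeroInvariant_H hN hq hp⟩

end HB

end

theorem mainTheorem3 :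
    (∀ S : Subgroup HB.GG,
      (S ≤ HB.KK ∧ IsClosed (S : Set HB.GG) ∧ (S : Set HB.GG).Infinite ∧
          HB.HasNonzeroInvariant S) ↔
        ∃ (N : ℕ) (q p : ℤ), HB.Admissible N q p ∧ S = HB.H N q p) ∧
    (∀ (N : ℕ) (q p : ℤ), HB.Admissible N q p → HB.lieDim (HB.H N q p) = 1) ∧
    (∀ S : Subgroup HB.GG,
      (HB.IsPotentialLittleGroup S ∧ (S : Set HB.GG).Infinite) ↔
        ∃ (g : HB.GG) (N : ℕ) (q p : ℤ), HB.Admissible N q p ∧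
          S = (HB.H N q p).map (MulAut.conj g).toMonoidHom) := by
  refine ⟨HB.infinite_le_KK_iff, ?_, fun S => ⟨?_, ?_⟩⟩
  · rintro N q p ⟨hN, -, -, -, hp0⟩
    exact HB.lieDim_H hN.pos.ne' hp0.ne'
  · rintro ⟨⟨hcl, hinv⟩, hinf⟩
    obtain ⟨g, hg⟩ := hinv.exists_conj_le_KK
    obtain ⟨N, q, p, hadm, h⟩ := (HB.infinite_le_KK_iff _).1
      ⟨hg, HB.isClosed_map_conj hcl g, HB.infinite_map_conj hinf g, hinv.map_conj g⟩
    refine ⟨g⁻¹, N, q, p, hadm, ?_⟩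
    rw [← h, HB.map_conj_inv_map_conj]
  · rintro ⟨g, N, q, p, hadm, rfl⟩
    obtain ⟨-, hcl, hinf, hinv⟩ := (HB.infinite_le_KK_iff _).2 ⟨N, q, p, hadm, rfl⟩
    exact ⟨⟨HB.isClosed_map_conj hcl g, hinv.map_conj g⟩, HB.infinite_map_conj hinf g⟩
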